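/- Let $T>0$, let $K:\mathbb{R}^{d+1}\to\mathbb{R}$ be a translation-invariant kernel, $K(\xi,\eta)=K(\xi-\eta)$, with reproducing kernel Hilbert space $\mathcal{H}$ (a space of real functions on $\mathbb{R}^{d+1}=\mathbb{R}\times\mathbb{R}^d$), and let $\widehat K$ be its Fourier transform. Let $p(t,x)$, $(t,x)\in[0,T]\times\mathbb{R}^d$, be a family of densities. Assume: (A1) $K$ is continuous, integrable and positive definite, and $\mathrm{supp}\,\widehat K=\mathbb{R}^{d+1}$. (A2) $\int_{\mathbb{R}^{d+1}}(1+|z|^2)\,\widehat K(z)\,dz<\infty$. (A3) $p\in C([0,T];L^1(\mathbb{R}^d))\cap L^\infty([0,T]\times\mathbb{R}^d)$, each $p(t,\cdot)$ is a probability density on $\mathbb{R}^d$, and the weak derivative $\partial_t p$ exists in $L^1((0,T)\times\mathbb{R}^d)$. For $u\in L^1([0,T]\times\mathbb{R}^d;\mathbb{R}^d,\,p(t,x)\,dt\,dx)$ write $\mathcal{A}^u\varphi=\partial_t\varphi+u^{\mathsf T}\nabla_x\varphi$ and, for $s\in[0,T]$ and $\xi=(t,x)\in\mathbb{R}^{d+1}$,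 $$H_s^u(\xi)=\int_0^s\!\int_{\mathbb{R}^d}p(r,y)\,\mathcal{A}^u_{r,y}K(\xi-(r,y))\,dy\,dr-\int_{\mathbb{R}^d}p(s,y)K(\xi-(s,y))\,dy+\int_{\mathbb{R}^d}p(0,y)K(\xi-(0,y))\,dy,$$ where $\mathcal{A}^u_{r,y}$ acts on the variable $(r,y)$. Call $u$ admissible if $\mathrm{div}_x(pu)\in L^1((0,T)\times\mathbb{R}^d)$ in the weak sense and $$\int_{\mathbb{R}^d}\varphi(t,x)p(t,x)\,dx-\int_{\mathbb{R}^d}\varphi(0,x)p(0,x)\,dx=\int_0^t\!\int_{\mathbb{R}^d}\mathcal{A}^u\varphi(s,x)\,p(s,x)\,dx\,ds$$ for every $\varphi\in C^1_b([0,T]\times\mathbb{R}^d)$ (functions that are $C^1$ up to the boundary and bounded together with their first derivatives) and every $t\in[0,T]$. Then $K\in C^1(\mathbb{R}^{d+1})$, and for every $u\in L^1([0,T]\times\mathbb{R}^d;\mathbb{R}^d,\,p\,dt\,dx)$: 1. for every $\xi\in\mathbb{R}^{d+1}$ the function $(r,y)\mapsto p(r,y)\,\mathcal{A}^u_{r,y}K(\xi-(r,y))$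 is integrable on $[0,T]\times\mathbb{R}^d$, so that $H_s^u$ is well defined; 2. $H_s^u\in\mathcal{H}$ for every $s\in[0,T]$; 3. $u$ is admissible if and only if $H_s^u=0$ (as a function on $\mathbb{R}^{d+1}$) for every $s\in[0,T]$. -/

import Mathlib

open MeasureTheory Set Filter Topology
open scoped ContDiff ENNReal FourierTransform InnerProductSpace

/-- The spatial domain `ℝ^d` with its Euclidean structure. -/
abbrev Space (d : ℕ) : Type := EuclideanSpace ℝ (Fin d)

/-- Space-time `ℝ^{d+1} = ℝ × ℝ^d` with its Euclidean structure; the point with time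
coordinate `t` and space coordinate `x` is `WithLp.toLp 2 (t, x)`. -/
abbrev SpaceTime (d : ℕ) : Type := WithLp 2 (ℝ × Space d)

/-- The closed slab `[0,T] × ℝ^d`. -/
def slab (d : ℕ) (T : ℝ) : Set (ℝ × Space d) := Icc 0 T ×ˢ univ

/-! ### The kernel -/

/-- Condition (A1) for a translation-invariant kernel `K(ξ, η) = K(ξ - η)`.  Universality is
the condition that the Fourier transform of `K` has full (closed) support. The Fourier transform
is the one of Mathlib, `𝓕 K z = ∫ e^{-2πi⟨ξ,z⟩} K(ξ) dξ`; passing to any other normalisation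
rescales `z` and multiplies by a positive constant, which does not affect the condition. -/
structure KernelA1 {d : ℕ} (K : SpaceTime d → ℝ) : Prop where
  continuous : Continuous K
  integrable : Integrable K
  posDef : Matrix.PosSemidef (Matrix.of fun ξ η : SpaceTime d => K (ξ - η))
  support_eq : tsupport (𝓕 (fun ξ => (K ξ : ℂ))) = univ

/-- Condition (A2): the Fourier transform of `K` has a finite second moment, that is
`∫ (1 + |z|²) K̂(z) dz < ∞`. It does not depend on the normalisation of the Fourier transform. -/
def KernelA2 {d : ℕ} (K : SpaceTime d → ℝ) : Prop :=
  Integrable fun z : SpaceTime d => (1 + ‖z‖ ^ 2) * ‖𝓕 (fun ξ => (K ξ : ℂ)) z‖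

/-- `𝓗` is the reproducing kernel Hilbert space of the translation-invariant kernel `K`: its
reproducing kernel is `(ξ, η) ↦ K (ξ - η)`. -/
def IsRKHSOf {d : ℕ} (K : SpaceTime d → ℝ) (𝓗 : Type*) [NormedAddCommGroup 𝓗]
    [InnerProductSpace ℝ 𝓗] [CompleteSpace 𝓗] [RKHS ℝ 𝓗 (SpaceTime d) ℝ] : Prop :=
  ∀ ξ η : SpaceTime d, RKHS.kernel 𝓗 ξ η 1 = K (ξ - η)

/-! ### The operator `𝒜^u` and weak derivatives -/

/-- `𝒜^u φ (r, y) = ∂_t φ(r, y) + u(r, y)ᵀ ∇_x φ(r, y)`. -/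
noncomputable def genA {d : ℕ} (u : ℝ → Space d → Space d) (φ : ℝ × Space d → ℝ)
    (r : ℝ) (y : Space d) : ℝ :=
  deriv (fun t => φ (t, y)) r + ⟪u r y, gradient (fun x => φ (r, x)) y⟫_ℝ

/-- Smooth test functions with compact support in the open slab `(0,T) × ℝ^d`. -/
def IsTestFunction {d : ℕ} (T : ℝ) (φ : ℝ × Space d → ℝ) : Prop :=
  ContDiff ℝ ∞ φ ∧ HasCompactSupport φ ∧ tsupport φ ⊆ Ioo 0 T ×ˢ univ

/-- The weak time derivative of `p` on `(0,T) × ℝ^d` exists and belongs to `L¹`. -/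
def HasWeakTimeDerivL1 {d : ℕ} (T : ℝ) (p : ℝ → Space d → ℝ) : Prop :=
  ∃ g : ℝ × Space d → ℝ, IntegrableOn g (Ioo 0 T ×ˢ univ) ∧
    ∀ φ : ℝ × Space d → ℝ, IsTestFunction T φ →
      ∫ q in Ioo 0 T ×ˢ univ, p q.1 q.2 * deriv (fun t => φ (t, q.2)) q.1
        = -∫ q in Ioo 0 T ×ˢ univ, g q * φ q

/-- The weak spatial divergence `div_x (p u)` on `(0,T) × ℝ^d` exists and belongs to `L¹`. -/
def HasWeakDivL1 {d : ℕ} (T : ℝ) (p : ℝ → Space d → ℝ) (u : ℝ → Space d → Space d) : Prop :=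
  ∃ g : ℝ × Space d → ℝ, IntegrableOn g (Ioo 0 T ×ˢ univ) ∧
    ∀ φ : ℝ × Space d → ℝ, IsTestFunction T φ →
      ∫ q in Ioo 0 T ×ˢ univ,
          p q.1 q.2 * ⟪u q.1 q.2, gradient (fun x => φ (q.1, x)) q.2⟫_ℝ
        = -∫ q in Ioo 0 T ×ˢ univ, g q * φ q

/-! ### The marginal flow -/

/-- Condition (A3) on the densities `p(t, ·)`. -/
structure MarginalA3 {d : ℕ} (T : ℝ) (p : ℝ → Space d → ℝ) : Prop where
  nonneg : ∀ t ∈ Icc 0 T, 0 ≤ᵐ[volume] p t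
  integrable : ∀ t ∈ Icc 0 T, Integrable (p t)
  integral_eq_one : ∀ t ∈ Icc 0 T, ∫ x, p t x = 1
  continuous_L1 : ∀ t ∈ Icc 0 T,
    Tendsto (fun s => eLpNorm (p s - p t) 1 volume) (𝓝[Icc 0 T] t) (𝓝 0)
  memLp_top : MemLp (fun q : ℝ × Space d => p q.1 q.2) ∞ (volume.restrict (slab d T))
  weakDeriv : HasWeakTimeDerivL1 T p

/-- The measure `p(t,x) dt dx` on `[0,T] × ℝ^d`. -/
noncomputable def flowMeasure {d : ℕ} (T : ℝ) (p : ℝ → Space d → ℝ) : Measure (ℝ × Space d) :=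
  (volume.restrict (slab d T)).withDensity fun q => ENNReal.ofReal (p q.1 q.2)

/-- `u ∈ L¹([0,T] × ℝ^d; ℝ^d, p dt dx)`. -/
def VelocityL1 {d : ℕ} (T : ℝ) (p : ℝ → Space d → ℝ) (u : ℝ → Space d → Space d) : Prop :=
  Integrable (fun q : ℝ × Space d => u q.1 q.2) (flowMeasure T p)

/-- `φ ∈ C¹_b([0,T] × ℝ^d)`: continuously differentiable up to the boundary of the slab, and
bounded together with its first derivatives. -/
def IsCb1 {d : ℕ} (T : ℝ) (φ : ℝ × Space d → ℝ) : Prop :=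
  ContDiffOn ℝ 1 φ (slab d T) ∧
    ∃ C : ℝ, ∀ q ∈ slab d T, |φ q| ≤ C ∧ ‖fderivWithin ℝ φ (slab d T) q‖ ≤ C

/-- The set `𝒰₀` of admissible velocity fields: `u` is `p dt dx`-integrable, `div_x (p u)` is in
`L¹` weakly, and `(u, p)` satisfies the weak continuity equation on every `[0,t]`. -/
def IsAdmissible {d : ℕ} (T : ℝ) (p : ℝ → Space d → ℝ) (u : ℝ → Space d → Space d) : Prop :=
  VelocityL1 T p u ∧ HasWeakDivL1 T p u ∧
    ∀ φ : ℝ × Space d → ℝ, IsCb1 T φ → ∀ t ∈ Icc 0 T,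
      (∫ x, φ (t, x) * p t x) - ∫ x, φ (0, x) * p 0 x
        = ∫ s in (0 : ℝ)..t, ∫ x, genA u φ s x * p s x

/-! ### The residual -/

/-- The section `(r, y) ↦ K(ξ, (r, y)) = K(ξ - (r, y))`. -/
def kernelSection {d : ℕ} (K : SpaceTime d → ℝ) (ξ : SpaceTime d) (q : ℝ × Space d) : ℝ :=
  K (ξ - WithLp.toLp 2 q)

/-- The kernel residual `H_s^u`, a function of `ξ = (t, x) ∈ ℝ^{d+1}`. -/
noncomputable def kernelResidual {d : ℕ} (K : SpaceTime d → ℝ) (p : ℝ → Space d → ℝ)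
    (u : ℝ → Space d → Space d) (s : ℝ) (ξ : SpaceTime d) : ℝ :=
  (∫ r in (0 : ℝ)..s, ∫ y, p r y * genA u (kernelSection K ξ) r y)
    - (∫ y, p s y * kernelSection K ξ (s, y))
    + ∫ y, p 0 y * kernelSection K ξ (0, y)

/-!
The residual `H_s^u(ξ)` is the value on the kernel section `K(ξ - ·)` of one linear functional, the
weak residual
`Λ_s φ = ∫_{(0,s) × ℝ^d} Dφ(1,u) p dt dx - ∫ φ(s,·) p(s,·) dx + ∫ φ(0,·) p(0,·) dx`,
whose vanishing on `C¹_b` for all `s` is the weak continuity equation. The theorem follows from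
three properties of `Λ_s`.

*Boundedness on the Hilbert space.* By Fourier inversion and the second moment of `K̂`, the second
difference `2 K(0) - K(w) - K(-w)` is at most `L² |w|²` (`exists_second_difference_le`). This is the
square of a distance between two kernel functions, so every `f ∈ 𝓗` is Lipschitz with constant
`L ‖f‖` (`IsRKHSOf.exists_lipschitz`). Hence `Λ_s` is bounded on the `C¹` elements of `𝓗`, and a
Hahn-Banach extension represented by Riesz gives an element of `𝓗` whose value at `ξ` is `H_s^u(ξ)`
(`exists_coe_eq_kernelResidual`). No Hilbert-space-valued integral is needed.

*Determination by the kernel sections.* On a Fourier transform `𝓕 g`, the functional is integration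
of `g` against a continuous symbol of linear growth, its value on the characters
(`transportFunctional_fourier`). If `H_s^u = 0`, the inverse Fourier transform of `K̂` times the symbol
is zero, so the symbol vanishes where `K̂ ≠ 0`, a dense set, hence everywhere
(`transportSymbol_eq_zero`). So `Λ_s` vanishes on Schwartz functions.

*Continuity under bounded pointwise convergence* of functions and derivatives
(`tendsto_weakResidual`). It carries the vanishing from test functions to `C¹_b([0,T] × ℝ^d)`, by
mollification, truncation, and a contraction of the time axis that moves the boundary of the slab
inside (`weakResidual_eq_zero_of_isCb1`).

Conversely, the kernel sections are themselves in `C¹_b`. The weak divergence of `p u` comes for free: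
the continuity equation on `[0,T]`, tested against functions supported in the open slab, says that it
is minus the weak time derivative of `p` (`hasWeakDivL1_of_weakResidual_eq_zero`).
-/

/-! ### First-order functionals and the Fourier transform -/

section FourierFunctional

open Real Complex

section PlaneWave

variable {E : Type*} [NormedAddCommGroup E] [InnerProductSpace ℝ E]

/-- The character `x ↦ exp (-2πi ⟨z, x⟩)`. -/
noncomputable def planeWave (z x : E) : ℂ := Complex.exp (↑(-(2 * π * ⟪z, x⟫_ℝ)) * I)

lemma fourierChar_neg_inner_smul (z x : E) (c : ℂ) :
    𝐞 (-⟪z, x⟫_ℝ) • c = planeWave z x * c := by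
  rw [Circle.smul_def, smul_eq_mul, Real.fourierChar_apply, planeWave]
  congr 4
  ring

lemma fourierChar_inner_smul (z x : E) (c : ℂ) : 𝐞 ⟪z, x⟫_ℝ • c = planeWave z (-x) * c := by
  rw [← fourierChar_neg_inner_smul, inner_neg_right, neg_neg]

lemma norm_planeWave (z x : E) : ‖planeWave z x‖ = 1 := by
  rw [planeWave, norm_exp_ofReal_mul_I]

lemma planeWave_sub (z x y : E) : planeWave z (x - y) = planeWave z x * planeWave z (-y) := by
  simp only [planeWave, ← Complex.exp_add, inner_sub_right, inner_neg_right]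
  congr 1
  push_cast
  ring

@[fun_prop]
lemma continuous_planeWave {A : Type*} [TopologicalSpace A] {f g : A → E} (hf : Continuous f)
    (hg : Continuous g) : Continuous fun x => planeWave (f x) (g x) := by
  unfold planeWave
  fun_prop

lemma integrable_planeWave {Y : Type*} [MeasurableSpace Y] [MeasurableSpace E] [BorelSpace E]
    (μ : Measure Y) [IsFiniteMeasure μ] {b : Y → E} (hb : AEMeasurable b μ) (z : E) :
    Integrable (fun y => planeWave z (b y)) μ := by
  refine Integrable.of_bound (C := 1) ?_ (ae_of_all _ fun y => (norm_planeWave _ _).le)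
  have : Continuous fun x : E => planeWave z x := by fun_prop
  exact (this.measurable.comp_aemeasurable hb).aestronglyMeasurable

lemma norm_integral_planeWave_le {Y : Type*} [MeasurableSpace Y] (μ : Measure Y)
    [IsFiniteMeasure μ] (b : Y → E) (z : E) :
    ‖∫ y, planeWave z (b y) ∂μ‖ ≤ μ.real univ := by
  simpa using norm_integral_le_of_norm_le_const (μ := μ) (C := 1)
    (f := fun y => planeWave z (b y)) (ae_of_all _ fun y => (norm_planeWave _ _).le)

lemma norm_symbol_integrand {X : Type*} {a w : X → E} (z : E) (q : X) :
    ‖-(2 * π * I) * ⟪z, w q⟫_ℝ * planeWave z (a q)‖ ≤ 2 * π * (‖z‖ * ‖w q‖) := by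
  have := abs_real_inner_le_norm z (w q)
  simp only [norm_mul, norm_neg, norm_planeWave, mul_one, norm_I, norm_real, Complex.norm_ofNat,
    norm_eq_abs, abs_of_pos pi_pos]
  gcongr

lemma continuous_integral_planeWave {Y : Type*} [MeasurableSpace Y] [MeasurableSpace E]
    [BorelSpace E] (μ : Measure Y) [IsFiniteMeasure μ] {b : Y → E} (hb : AEMeasurable b μ) :
    Continuous fun z => ∫ y, planeWave z (b y) ∂μ := by
  refine continuous_of_dominated (bound := fun _ => 1)
    (fun z => (integrable_planeWave μ hb z).aestronglyMeasurable)
    (fun z => ae_of_all _ fun y => (norm_planeWave _ _).le) (integrable_const _)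
    (ae_of_all _ fun y => ?_)
  fun_prop

lemma norm_integral_symbol_le {X : Type*} [MeasurableSpace X] {ν : Measure X} {a w : X → E}
    (hw : Integrable w ν) (z : E) :
    ‖∫ q, -(2 * π * I) * ⟪z, w q⟫_ℝ * planeWave z (a q) ∂ν‖ ≤ 2 * π * (∫ q, ‖w q‖ ∂ν) * ‖z‖ := by
  refine (norm_integral_le_of_norm_le ((hw.norm.const_mul _).const_mul _)
    (ae_of_all _ fun q => norm_symbol_integrand z q)).trans (le_of_eq ?_)
  rw [integral_const_mul, integral_const_mul]
  ring

end PlaneWave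

variable {E X Y : Type*} [NormedAddCommGroup E] [InnerProductSpace ℝ E] [FiniteDimensional ℝ E]
  [MeasurableSpace E] [BorelSpace E] [MeasurableSpace X] [MeasurableSpace Y]

/-- The transport functional
`F ↦ ∫ DF(a(q)) w(q) dν(q) - ∫ F(b₁(y)) dμ₁(y) + ∫ F(b₀(y)) dμ₀(y)`. -/
noncomputable def transportFunctional (ν : Measure X) (a w : X → E) (μ₁ μ₀ : Measure Y)
    (b₁ b₀ : Y → E) (F : E → ℂ) : ℂ :=
  ∫ q, fderiv ℝ F (a q) (w q) ∂ν - ∫ y, F (b₁ y) ∂μ₁ + ∫ y, F (b₀ y) ∂μ₀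

/-- The symbol of the transport functional: its value on the character
`x ↦ exp (-2πi ⟨z, x⟩)`. -/
noncomputable def transportSymbol (ν : Measure X) (a w : X → E) (μ₁ μ₀ : Measure Y)
    (b₁ b₀ : Y → E) (z : E) : ℂ :=
  ∫ q, -(2 * π * I) * ⟪z, w q⟫_ℝ * planeWave z (a q) ∂ν
    - ∫ y, planeWave z (b₁ y) ∂μ₁ + ∫ y, planeWave z (b₀ y) ∂μ₀

lemma integral_fourier_comp (μ : Measure Y) [IsFiniteMeasure μ] {b : Y → E}
    (hb : AEMeasurable b μ) {g : E → ℂ} (hg : Integrable g) :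
    ∫ y, 𝓕 g (b y) ∂μ = ∫ z, g z * ∫ y, planeWave z (b y) ∂μ := by
  simp_rw [Real.fourier_eq, ← integral_const_mul]
  rw [integral_integral_swap]
  · simp [fourierChar_neg_inner_smul, mul_comm]
  · have h1 : Integrable (fun q : Y × E => g q.2) (μ.prod volume) := hg.comp_snd μ
    have hc : Continuous fun q : E × E => planeWave q.1 q.2 := by fun_prop
    have h2 : AEStronglyMeasurable (fun q : Y × E => planeWave q.2 (b q.1))
        (μ.prod volume) :=
      (hc.measurable.comp_aemeasurable
        (measurable_snd.aemeasurable.prodMk hb.comp_fst)).aestronglyMeasurable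
    simp only [fourierChar_neg_inner_smul]
    exact h1.bdd_mul (c := 1) h2 (ae_of_all _ fun q => (norm_planeWave _ _).le)

variable {ν : Measure X} {a w : X → E}

lemma aestronglyMeasurable_symbol_integrand (ha : AEMeasurable a ν) (hw : Integrable w ν) (z : E) :
    AEStronglyMeasurable (fun q => -(2 * π * I) * ⟪z, w q⟫_ℝ * planeWave z (a q)) ν := by
  have hc : Continuous fun q : E × E => -(2 * π * I) * ⟪z, q.1⟫_ℝ * planeWave z q.2 := by
    fun_prop
  exact (hc.measurable.comp_aemeasurable
    (hw.1.aemeasurable.prodMk ha)).aestronglyMeasurable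

lemma continuous_integral_symbol (ha : AEMeasurable a ν) (hw : Integrable w ν) :
    Continuous fun z => ∫ q, -(2 * π * I) * ⟪z, w q⟫_ℝ * planeWave z (a q) ∂ν := by
  refine continuous_iff_continuousAt.2 fun z => ?_
  refine continuousAt_of_dominated (bound := fun q => 2 * π * ((‖z‖ + 1) * ‖w q‖))
    (Eventually.of_forall fun z => aestronglyMeasurable_symbol_integrand ha hw z) ?_
    ((hw.norm.const_mul _).const_mul _) (ae_of_all _ fun q => ?_)
  · filter_upwards [Metric.ball_mem_nhds z one_pos] with z' hz'
    refine ae_of_all _ fun q => (norm_symbol_integrand z' q).trans ?_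
    have : ‖z'‖ ≤ ‖z‖ + 1 := by
      have h := norm_le_norm_add_norm_sub z z'
      rw [mem_ball_iff_norm'] at hz'
      linarith
    gcongr
  · have hc : Continuous fun z => -(2 * π * I) * ⟪z, w q⟫_ℝ * planeWave z (a q) := by
      fun_prop
    exact hc.continuousAt

lemma fderiv_fourier_apply {g : E → ℂ} (hg : Integrable g)
    (hg' : Integrable fun z => ‖z‖ * ‖g z‖) (x v : E) :
    fderiv ℝ (𝓕 g) x v = ∫ z, g z * (-(2 * π * I) * ⟪z, v⟫_ℝ * planeWave z x) := by
  rw [Real.fderiv_fourier hg hg', Real.fourier_eq, ContinuousLinearMap.integral_apply]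
  · refine integral_congr_ae (ae_of_all _ fun z => ?_)
    have : (𝐞 (-⟪z, x⟫_ℝ) • VectorFourier.fourierSMulRight (innerSL ℝ) g z) v
        = 𝐞 (-⟪z, x⟫_ℝ) • VectorFourier.fourierSMulRight (innerSL ℝ) g z v := rfl
    beta_reduce
    rw [this, fourierChar_neg_inner_smul, VectorFourier.fourierSMulRight_apply,
      innerSL_apply_apply, real_smul, smul_eq_mul]
    ring
  · rw [Real.fourierIntegral_convergent_iff]
    refine (hg'.const_mul (2 * π * ‖innerSL ℝ (E := E)‖)).mono'
      hg.1.fourierSMulRight (ae_of_all _ fun z => ?_)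
    refine (VectorFourier.norm_fourierSMulRight_le _ _ _).trans (le_of_eq ?_)
    ring

lemma integral_fderiv_fourier_comp [SFinite ν] (ha : AEMeasurable a ν) (hw : Integrable w ν)
    {g : E → ℂ} (hg : Integrable g) (hg' : Integrable fun z => ‖z‖ * ‖g z‖) :
    ∫ q, fderiv ℝ (𝓕 g) (a q) (w q) ∂ν
      = ∫ z, g z * ∫ q, -(2 * π * I) * ⟪z, w q⟫_ℝ * planeWave z (a q) ∂ν := by
  simp_rw [fderiv_fourier_apply hg hg', ← integral_const_mul]
  rw [integral_integral_swap]
  have h1 : Integrable (fun q : X × E => ‖w q.1‖ * (‖q.2‖ * ‖g q.2‖)) (ν.prod volume) :=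
    hw.norm.mul_prod hg'
  have hc : Continuous fun q : E × E × E =>
      -(2 * π * I) * ⟪q.1, q.2.1⟫_ℝ * planeWave q.1 q.2.2 := by fun_prop
  have h2 : AEStronglyMeasurable (fun q : X × E =>
      -(2 * π * I) * ⟪q.2, w q.1⟫_ℝ * planeWave q.2 (a q.1)) (ν.prod volume) :=
    (hc.measurable.comp_aemeasurable (measurable_snd.aemeasurable.prodMk
      (hw.1.aemeasurable.comp_fst.prodMk ha.comp_fst))).aestronglyMeasurable
  refine (h1.const_mul (2 * π)).mono' (hg.1.comp_snd.mul h2) (ae_of_all _ fun q => ?_)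
  simp only [Function.uncurry, norm_mul (g q.2)]
  refine (mul_le_mul_of_nonneg_left (norm_symbol_integrand _ _) (norm_nonneg _)).trans
    (le_of_eq ?_)
  ring

variable {μ₁ μ₀ : Measure Y} [IsFiniteMeasure μ₁] [IsFiniteMeasure μ₀] {b₁ b₀ : Y → E}

lemma continuous_transportSymbol (ha : AEMeasurable a ν) (hw : Integrable w ν)
    (hb₁ : AEMeasurable b₁ μ₁) (hb₀ : AEMeasurable b₀ μ₀) :
    Continuous (transportSymbol ν a w μ₁ μ₀ b₁ b₀) :=
  ((continuous_integral_symbol ha hw).sub (continuous_integral_planeWave μ₁ hb₁)).add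
    (continuous_integral_planeWave μ₀ hb₀)

lemma norm_mul_transportSymbol_le (hw : Integrable w ν) (g : E → ℂ) (z : E) :
    ‖g z * transportSymbol ν a w μ₁ μ₀ b₁ b₀ z‖
      ≤ 2 * π * (∫ q, ‖w q‖ ∂ν) * (‖z‖ * ‖g z‖) + (μ₁.real univ + μ₀.real univ) * ‖g z‖ := by
  have : ‖transportSymbol ν a w μ₁ μ₀ b₁ b₀ z‖
      ≤ 2 * π * (∫ q, ‖w q‖ ∂ν) * ‖z‖ + μ₁.real univ + μ₀.real univ :=
    (norm_add_le _ _).trans (add_le_add ((norm_sub_le _ _).trans (add_le_add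
      (norm_integral_symbol_le hw z) (norm_integral_planeWave_le _ _ _)))
      (norm_integral_planeWave_le _ _ _))
  rw [norm_mul]
  refine (mul_le_mul_of_nonneg_left this (norm_nonneg _)).trans (le_of_eq ?_)
  ring

/-- The transport functional acts on a Fourier transform as integration against its symbol. -/
lemma transportFunctional_fourier [SFinite ν] (ha : AEMeasurable a ν) (hw : Integrable w ν)
    (hb₁ : AEMeasurable b₁ μ₁) (hb₀ : AEMeasurable b₀ μ₀)
    {g : E → ℂ} (hg : Integrable g) (hg' : Integrable fun z => ‖z‖ * ‖g z‖) :
    transportFunctional ν a w μ₁ μ₀ b₁ b₀ (𝓕 g)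
      = ∫ z, g z * transportSymbol ν a w μ₁ μ₀ b₁ b₀ z := by
  have i1 : Integrable fun z => g z * ∫ q, -(2 * π * I) * ⟪z, w q⟫_ℝ * planeWave z (a q) ∂ν := by
    refine (hg'.const_mul (2 * π * (∫ q, ‖w q‖ ∂ν))).mono'
      (hg.1.mul (continuous_integral_symbol ha hw).aestronglyMeasurable)
      (ae_of_all _ fun z => ?_)
    rw [norm_mul]
    refine (mul_le_mul_of_nonneg_left (norm_integral_symbol_le hw z) (norm_nonneg _)).trans
      (le_of_eq ?_)
    ring
  have i2 : ∀ (μ : Measure Y) [IsFiniteMeasure μ] (b : Y → E), AEMeasurable b μ →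
      Integrable fun z => g z * ∫ y, planeWave z (b y) ∂μ := fun μ _ b hb =>
    hg.mul_bdd (c := μ.real univ) (continuous_integral_planeWave μ hb).aestronglyMeasurable
      (ae_of_all _ fun z => norm_integral_planeWave_le μ b z)
  simp only [transportFunctional, transportSymbol, mul_add, mul_sub]
  rw [integral_add ?_ (i2 _ _ hb₀), integral_sub i1 (i2 _ _ hb₁),
    integral_fderiv_fourier_comp ha hw hg hg', integral_fourier_comp μ₁ hb₁ hg,
    integral_fourier_comp μ₀ hb₀ hg]
  exact i1.sub (i2 _ _ hb₁)

/-- If `k̂` is continuous, has full support and a first moment, and the transport functional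
vanishes on all the functions `η ↦ 𝓕⁻ k̂ (ξ - η)`, then its symbol vanishes: the inverse Fourier
transform of `k̂` times the symbol is zero, so that the symbol is zero on the dense set
`{k̂ ≠ 0}`. -/
lemma transportSymbol_eq_zero [SFinite ν] (ha : AEMeasurable a ν) (hw : Integrable w ν)
    (hb₁ : AEMeasurable b₁ μ₁) (hb₀ : AEMeasurable b₀ μ₀)
    {k : E → ℂ} (hkc : Continuous k) (hk : Integrable k) (hk' : Integrable fun z => ‖z‖ * ‖k z‖)
    (hsupp : tsupport k = univ)
    (h : ∀ ξ, transportFunctional ν a w μ₁ μ₀ b₁ b₀ (fun η => 𝓕⁻ k (ξ - η)) = 0) :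
    transportSymbol ν a w μ₁ μ₀ b₁ b₀ = 0 := by
  set c := transportSymbol ν a w μ₁ μ₀ b₁ b₀ with hc
  have hcc : Continuous c := continuous_transportSymbol ha hw hb₁ hb₀
  have hshift : ∀ ξ, (fun η => 𝓕⁻ k (ξ - η)) = 𝓕 fun z => planeWave z (-ξ) * k z := by
    intro ξ
    ext η
    rw [Real.fourierInv_eq, Real.fourier_eq]
    refine integral_congr_ae (ae_of_all _ fun z => ?_)
    beta_reduce
    rw [fourierChar_neg_inner_smul, fourierChar_inner_smul, neg_sub, ← mul_assoc, planeWave_sub]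
  have hnorm : ∀ ξ z, ‖planeWave z (-ξ) * k z‖ = ‖k z‖ := fun ξ z => by
    rw [norm_mul, norm_planeWave, one_mul]
  have hinv : 𝓕⁻ (fun z => k z * c z) = 0 := by
    ext ξ
    have h1 : Integrable fun z => planeWave z (-ξ) * k z := by
      refine hk.mono (Continuous.aestronglyMeasurable (by fun_prop)) (ae_of_all _ fun z => ?_)
      rw [hnorm]
    have := h ξ
    rw [hshift, transportFunctional_fourier ha hw hb₁ hb₀ h1 (by simpa only [hnorm] using hk')]
      at this
    rw [Real.fourierInv_eq, Pi.zero_apply, ← this]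
    refine integral_congr_ae (ae_of_all _ fun z => ?_)
    beta_reduce
    rw [fourierChar_inner_smul, ← hc, mul_assoc]
  have hint : Integrable fun z => k z * c z :=
    ((hk'.const_mul _).add (hk.norm.const_mul _)).mono' (hkc.mul hcc).aestronglyMeasurable
      (ae_of_all _ fun z => norm_mul_transportSymbol_le hw k z)
  have hzero : (fun z => k z * c z) = 0 := by
    have hF : Integrable (𝓕 fun z => k z * c z) := by
      have : 𝓕 (fun z => k z * c z) = 0 := by
        ext ξ
        have := congrFun hinv (-ξ)
        rwa [Real.fourierInv_eq_fourier_neg, neg_neg] at this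
      rw [this]
      exact integrable_zero _ _ _
    have hkcc : Continuous fun z => k z * c z := hkc.mul hcc
    rw [← hkcc.fourierInv_fourier_eq hint hF, Real.fourierInv_eq_fourier_comp_neg]
    ext ξ
    have : (fun x : E => 𝓕 (fun z => k z * c z) (-x)) = 0 := by
      ext x
      have := congrFun hinv x
      rwa [Real.fourierInv_eq_fourier_neg] at this
    rw [this]
    simp [Real.fourier_eq]
  have hdense : Dense (Function.support k) := by
    rw [dense_iff_closure_eq]; exact hsupp
  refine hcc.ext_on hdense continuous_zero fun z hz => ?_
  have := congrFun hzero z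
  exact (mul_eq_zero.1 this).resolve_left hz

/-- A transport functional with vanishing symbol vanishes on Schwartz functions. -/
lemma transportFunctional_schwartz_eq_zero [SFinite ν] (ha : AEMeasurable a ν)
    (hw : Integrable w ν) (hb₁ : AEMeasurable b₁ μ₁) (hb₀ : AEMeasurable b₀ μ₀)
    (h : transportSymbol ν a w μ₁ μ₀ b₁ b₀ = 0) (f : SchwartzMap E ℂ) :
    transportFunctional ν a w μ₁ μ₀ b₁ b₀ f = 0 := by
  obtain ⟨g, hg⟩ : ∃ g : SchwartzMap E ℂ, 𝓕 (g : E → ℂ) = f :=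
    ⟨𝓕⁻ f, by rw [← SchwartzMap.fourier_coe, FourierTransform.fourier_fourierInv_eq]⟩
  rw [← hg, transportFunctional_fourier ha hw hb₁ hb₀ (SchwartzMap.integrable _)
    (by simpa using g.integrable_pow_mul volume 1), h]
  simp

end FourierFunctional

/-! ### Regularity of the kernel -/

section KernelRegularity

open Real Complex

variable {d : ℕ} {K : SpaceTime d → ℝ}

lemma KernelA1.continuous_fourier (hA1 : KernelA1 K) : Continuous (𝓕 fun ξ => (K ξ : ℂ)) :=
  VectorFourier.fourierIntegral_continuous continuous_fourierChar continuous_inner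
    hA1.integrable.ofReal

lemma KernelA2.integrable_pow_mul (hA1 : KernelA1 K) (hA2 : KernelA2 K) {n : ℕ} (hn : n ≤ 2) :
    Integrable fun z => ‖z‖ ^ n * ‖𝓕 (fun ξ => (K ξ : ℂ)) z‖ := by
  refine hA2.mono' ?_ (ae_of_all _ fun z => ?_)
  · have := hA1.continuous_fourier
    exact Continuous.aestronglyMeasurable (by fun_prop)
  · rw [norm_of_nonneg (by positivity)]
    gcongr
    have := norm_nonneg z
    interval_cases n <;> nlinarith

lemma KernelA2.integrable_fourier (hA1 : KernelA1 K) (hA2 : KernelA2 K) :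
    Integrable (𝓕 fun ξ => (K ξ : ℂ)) := by
  rw [← integrable_norm_iff hA1.continuous_fourier.aestronglyMeasurable]
  simpa using KernelA2.integrable_pow_mul hA1 hA2 (n := 0) (by norm_num)

lemma fourierInv_fourier_kernel (hA1 : KernelA1 K) (hA2 : KernelA2 K) :
    𝓕⁻ (𝓕 fun ξ => (K ξ : ℂ)) = fun ξ => (K ξ : ℂ) :=
  Continuous.fourierInv_fourier_eq (continuous_ofReal.comp hA1.continuous)
    hA1.integrable.ofReal (KernelA2.integrable_fourier hA1 hA2)

lemma contDiff_kernel (hA1 : KernelA1 K) (hA2 : KernelA2 K) : ContDiff ℝ 1 K := by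
  have h : ContDiff ℝ (1 : ℕ∞) (𝓕 (𝓕 fun ξ => (K ξ : ℂ))) :=
    Real.contDiff_fourier fun n hn => KernelA2.integrable_pow_mul hA1 hA2
      ((by exact_mod_cast hn : n ≤ 1).trans one_le_two)
  have hK : K = fun ξ => re (𝓕 (𝓕 fun ξ => (K ξ : ℂ)) (-ξ)) := by
    ext ξ
    rw [← Real.fourierInv_eq_fourier_neg, fourierInv_fourier_kernel hA1 hA2, ofReal_re]
  rw [hK]
  exact reCLM.contDiff.comp (h.comp contDiff_neg)

/-- The second difference of the kernel at the origin is quadratic, since its Fourier transform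
has a finite second moment. -/
lemma exists_second_difference_le (hA1 : KernelA1 K) (hA2 : KernelA2 K) :
    ∃ L : ℝ, 0 ≤ L ∧ ∀ w, 2 * K 0 - K w - K (-w) ≤ L ^ 2 * ‖w‖ ^ 2 := by
  set k := 𝓕 fun ξ => (K ξ : ℂ) with hk
  have hki : Integrable k := KernelA2.integrable_fourier hA1 hA2
  have hk2 : Integrable fun z => ‖z‖ ^ 2 * ‖k z‖ := KernelA2.integrable_pow_mul hA1 hA2 le_rfl
  have hM : 0 ≤ ∫ z, ‖z‖ ^ 2 * ‖k z‖ := integral_nonneg fun z => by positivity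
  refine ⟨2 * π * √(∫ z, ‖z‖ ^ 2 * ‖k z‖), by positivity, fun w => ?_⟩
  have hinv : ∀ ξ, (K ξ : ℂ) = ∫ z, planeWave z (-ξ) * k z := fun ξ => by
    rw [← congrFun (fourierInv_fourier_kernel hA1 hA2) ξ, Real.fourierInv_eq]
    simp_rw [fourierChar_inner_smul, hk]
  have hint : ∀ ξ, Integrable fun z => planeWave z (-ξ) * k z := fun ξ =>
    hki.bdd_mul (c := 1) (Continuous.aestronglyMeasurable (by fun_prop))
      (ae_of_all _ fun z => (norm_planeWave _ _).le)
  have hsum : ∀ z : SpaceTime d, planeWave z (-w) + planeWave z (- -w)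
      = ((2 * Real.cos (2 * π * ⟪z, w⟫_ℝ) : ℝ) : ℂ) := by
    intro z
    simp only [planeWave, inner_neg_right]
    rw [exp_mul_I, exp_mul_I, ← ofReal_cos, ← ofReal_cos, ← ofReal_sin, ← ofReal_sin]
    simp only [mul_neg, neg_neg, Real.cos_neg, Real.sin_neg]
    push_cast
    ring
  have hK : ((2 * K 0 - K w - K (-w) : ℝ) : ℂ)
      = ∫ z, ((2 - 2 * Real.cos (2 * π * ⟪z, w⟫_ℝ) : ℝ) : ℂ) * k z := by
    have h0 : ∀ z : SpaceTime d, planeWave z (-0) = 1 := fun z => by simp [planeWave]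
    push_cast
    rw [hinv, hinv, hinv, ← integral_const_mul, ← integral_sub ((hint 0).const_mul 2) (hint w),
      ← integral_sub (by exact ((hint 0).const_mul 2).sub (hint w)) (hint (-w))]
    refine integral_congr_ae (ae_of_all _ fun z => ?_)
    have := hsum z
    push_cast at this
    simp only [h0]
    linear_combination (-k z) * this
  have hle : |2 * K 0 - K w - K (-w)| ≤ ∫ z, (2 * π) ^ 2 * ‖w‖ ^ 2 * (‖z‖ ^ 2 * ‖k z‖) := by
    rw [← Real.norm_eq_abs, ← norm_real, hK]
    refine norm_integral_le_of_norm_le (hk2.const_mul _) (ae_of_all _ fun z => ?_)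
    rw [norm_mul, norm_real, ← mul_assoc]
    gcongr
    have h1 : 0 ≤ 2 - 2 * Real.cos (2 * π * ⟪z, w⟫_ℝ) := by
      linarith [Real.cos_le_one (2 * π * ⟪z, w⟫_ℝ)]
    have h2 := Real.one_sub_sq_div_two_le_cos (x := 2 * π * ⟪z, w⟫_ℝ)
    have h3 : ⟪z, w⟫_ℝ ^ 2 ≤ (‖z‖ * ‖w‖) ^ 2 := by
      rw [← sq_abs]
      have := abs_real_inner_le_norm z w
      gcongr
    rw [Real.norm_of_nonneg h1]
    nlinarith [mul_le_mul_of_nonneg_left h3 (sq_nonneg (2 * π))]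
  refine (le_abs_self _).trans (hle.trans (le_of_eq ?_))
  rw [integral_const_mul, mul_pow (2 * π) √_, Real.sq_sqrt hM]
  ring

end KernelRegularity

/-! ### Regularity of the reproducing kernel Hilbert space -/

section RKHSRegularity

variable {d : ℕ} {K : SpaceTime d → ℝ} {𝓗 : Type*} [NormedAddCommGroup 𝓗]
  [InnerProductSpace ℝ 𝓗] [CompleteSpace 𝓗] [RKHS ℝ 𝓗 (SpaceTime d) ℝ]

lemma IsRKHSOf.kerFun_apply (h𝓗 : IsRKHSOf K 𝓗) (ξ η : SpaceTime d) :
    RKHS.kerFun 𝓗 η (1 : ℝ) ξ = K (ξ - η) := by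
  rw [RKHS.kerFun_apply, h𝓗]

lemma apply_eq_inner_kerFun (f : 𝓗) (ξ : SpaceTime d) : f ξ = ⟪f, RKHS.kerFun 𝓗 ξ (1 : ℝ)⟫_ℝ := by
  simp

lemma IsRKHSOf.inner_kerFun_kerFun (h𝓗 : IsRKHSOf K 𝓗) (ξ η : SpaceTime d) :
    ⟪RKHS.kerFun 𝓗 η (1 : ℝ), RKHS.kerFun 𝓗 ξ (1 : ℝ)⟫_ℝ = K (ξ - η) := by
  rw [← apply_eq_inner_kerFun, h𝓗.kerFun_apply]

lemma IsRKHSOf.kernel_neg (h𝓗 : IsRKHSOf K 𝓗) (w : SpaceTime d) : K (-w) = K w := by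
  rw [← zero_sub, ← h𝓗.inner_kerFun_kerFun, real_inner_comm, h𝓗.inner_kerFun_kerFun, sub_zero]

lemma IsRKHSOf.abs_apply_le (h𝓗 : IsRKHSOf K 𝓗) (f : 𝓗) (ξ : SpaceTime d) :
    |f ξ| ≤ √(K 0) * ‖f‖ := by
  have hn : ‖RKHS.kerFun 𝓗 ξ (1 : ℝ)‖ = √(K 0) := by
    rw [@norm_eq_sqrt_real_inner 𝓗, h𝓗.inner_kerFun_kerFun, sub_self]
  rw [apply_eq_inner_kerFun, mul_comm, ← hn]
  exact abs_real_inner_le_norm _ _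

/-- The feature map `ξ ↦ K (· - ξ)` is Lipschitz, by the quadratic bound on the second difference
of `K`; hence every element of the reproducing kernel Hilbert space is Lipschitz, with a constant
controlled by its norm. -/
lemma IsRKHSOf.exists_lipschitz (h𝓗 : IsRKHSOf K 𝓗) (hA1 : KernelA1 K) (hA2 : KernelA2 K) :
    ∃ L : ℝ, 0 ≤ L ∧ ∀ (f : 𝓗) (ξ η : SpaceTime d), |f ξ - f η| ≤ L * ‖f‖ * ‖ξ - η‖ := by
  obtain ⟨L, hL, h⟩ := exists_second_difference_le hA1 hA2
  refine ⟨L, hL, fun f ξ η => ?_⟩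
  have hn : ‖RKHS.kerFun 𝓗 ξ (1 : ℝ) - RKHS.kerFun 𝓗 η (1 : ℝ)‖ ≤ L * ‖ξ - η‖ := by
    refine le_of_sq_le_sq ?_ (by positivity)
    rw [@norm_sub_sq_real 𝓗, ← real_inner_self_eq_norm_sq, ← real_inner_self_eq_norm_sq,
      h𝓗.inner_kerFun_kerFun, h𝓗.inner_kerFun_kerFun, h𝓗.inner_kerFun_kerFun, sub_self, sub_self]
    have := h (ξ - η)
    rw [h𝓗.kernel_neg] at this
    have hsymm : K (η - ξ) = K (ξ - η) := by rw [← h𝓗.kernel_neg, neg_sub]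
    rw [hsymm]
    nlinarith
  rw [apply_eq_inner_kerFun, apply_eq_inner_kerFun f η, ← inner_sub_right]
  refine (abs_real_inner_le_norm _ _).trans ?_
  nlinarith [mul_le_mul_of_nonneg_left hn (norm_nonneg f)]

lemma norm_fderiv_le_of_abs_sub_le {E : Type*} [NormedAddCommGroup E] [NormedSpace ℝ E]
    {f : E → ℝ} {C : ℝ} (hC : 0 ≤ C) (h : ∀ x y, |f x - f y| ≤ C * ‖x - y‖) (x : E) :
    ‖fderiv ℝ f x‖ ≤ C := by
  have : LipschitzWith ⟨C, hC⟩ f := LipschitzWith.of_dist_le_mul fun x y => by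
    rw [Real.dist_eq, dist_eq_norm]; exact h x y
  exact norm_fderiv_le_of_lipschitz ℝ this

end RKHSRegularity

/-! ### The flow measure -/

section FlowMeasure

variable {d : ℕ} {T : ℝ} {p : ℝ → Space d → ℝ} {u : ℝ → Space d → Space d}

lemma volume_restrict_prod_univ (I : Set ℝ) :
    (volume.restrict (I ×ˢ univ) : Measure (ℝ × Space d)) = (volume.restrict I).prod volume := by
  rw [Measure.volume_eq_prod, ← Measure.prod_restrict, Measure.restrict_univ]

lemma MarginalA3.aestronglyMeasurable (hA3 : MarginalA3 T p) :
    AEStronglyMeasurable (fun q : ℝ × Space d => p q.1 q.2) (volume.restrict (slab d T)) :=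
  hA3.memLp_top.1

lemma MarginalA3.nonneg_slab (hA3 : MarginalA3 T p) :
    ∀ᵐ q ∂volume.restrict (slab d T), 0 ≤ p q.1 q.2 := by
  set f := hA3.aestronglyMeasurable.mk with hf
  have hfm : Measurable f := hA3.aestronglyMeasurable.stronglyMeasurable_mk.measurable
  have hfp : ∀ᵐ q ∂volume.restrict (slab d T), p q.1 q.2 = f q :=
    hA3.aestronglyMeasurable.ae_eq_mk
  have hf0 : ∀ᵐ q ∂volume.restrict (slab d T), 0 ≤ f q := by
    rw [slab, volume_restrict_prod_univ] at hfp ⊢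
    rw [Measure.ae_prod_iff_ae_ae (measurableSet_le measurable_const hfm)]
    filter_upwards [Measure.ae_ae_of_ae_prod hfp, ae_restrict_mem measurableSet_Icc] with t h1 ht
    filter_upwards [h1, hA3.nonneg t ht] with x h2 h3
    rw [← h2]
    exact h3
  filter_upwards [hfp, hf0] with q h1 h2
  rwa [h1]

lemma MarginalA3.integrableOn_slab (hA3 : MarginalA3 T p) :
    IntegrableOn (fun q : ℝ × Space d => p q.1 q.2) (slab d T) := by
  have hm := hA3.aestronglyMeasurable
  rw [IntegrableOn]
  rw [slab, volume_restrict_prod_univ] at hm ⊢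
  rw [integrable_prod_iff hm]
  refine ⟨?_, ?_⟩
  · filter_upwards [ae_restrict_mem measurableSet_Icc] with t ht using hA3.integrable t ht
  · refine (integrable_const (1 : ℝ)).congr ?_
    filter_upwards [ae_restrict_mem measurableSet_Icc] with t ht
    rw [← hA3.integral_eq_one t ht]
    refine integral_congr_ae ?_
    filter_upwards [hA3.nonneg t ht] with x hx
    exact (Real.norm_of_nonneg hx).symm

lemma MarginalA3.isFiniteMeasure_flowMeasure (hA3 : MarginalA3 T p) :
    IsFiniteMeasure (flowMeasure T p) :=
  isFiniteMeasure_withDensity_ofReal hA3.integrableOn_slab.2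

/-- The marginal law `p(t, x) dx` at time `t`. -/
noncomputable def marginalMeasure (p : ℝ → Space d → ℝ) (t : ℝ) : Measure (Space d) :=
  volume.withDensity fun x => ENNReal.ofReal (p t x)

/-- The flow measure `p(t,x) dt dx` on the open slab `(0,s) × ℝ^d`. -/
noncomputable def openFlowMeasure (T : ℝ) (p : ℝ → Space d → ℝ) (s : ℝ) :
    Measure (ℝ × Space d) :=
  (flowMeasure T p).restrict (Ioo 0 s ×ˢ univ)

/-- The space-time velocity `(1, u)`. -/
def spaceTimeVelocity (u : ℝ → Space d → Space d) (q : ℝ × Space d) : ℝ × Space d :=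
  (1, u q.1 q.2)

lemma MarginalA3.isFiniteMeasure_openFlowMeasure (hA3 : MarginalA3 T p) (s : ℝ) :
    IsFiniteMeasure (openFlowMeasure T p s) := by
  have := hA3.isFiniteMeasure_flowMeasure
  unfold openFlowMeasure
  infer_instance

lemma MarginalA3.isFiniteMeasure_marginalMeasure (hA3 : MarginalA3 T p) {t : ℝ}
    (ht : t ∈ Icc 0 T) : IsFiniteMeasure (marginalMeasure p t) :=
  isFiniteMeasure_withDensity_ofReal (hA3.integrable t ht).2

lemma ae_openFlowMeasure_mem (s : ℝ) :
    ∀ᵐ q ∂openFlowMeasure (d := d) T p s, q ∈ Ioo 0 s ×ˢ (univ : Set (Space d)) :=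
  ae_restrict_mem (measurableSet_Ioo.prod MeasurableSet.univ)

lemma integrable_spaceTimeVelocity (hA3 : MarginalA3 T p) (hu : VelocityL1 T p u) (s : ℝ) :
    Integrable (spaceTimeVelocity u) (openFlowMeasure T p s) := by
  have := hA3.isFiniteMeasure_openFlowMeasure s
  exact (integrable_const (1 : ℝ)).prodMk (Integrable.restrict hu)

lemma openFlowMeasure_eq {s : ℝ} (hs : s ≤ T) :
    openFlowMeasure (d := d) T p s
      = (volume.restrict (Ioo 0 s ×ˢ univ)).withDensity fun q => ENNReal.ofReal (p q.1 q.2) := by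
  have hm : MeasurableSet (Ioo 0 s ×ˢ (univ : Set (Space d))) :=
    measurableSet_Ioo.prod MeasurableSet.univ
  rw [openFlowMeasure, flowMeasure, restrict_withDensity hm, Measure.restrict_restrict hm,
    slab, inter_eq_left.2 (prod_mono_left (Ioo_subset_Icc_self.trans (Icc_subset_Icc_right hs)))]

lemma restrict_openSlab_le {s : ℝ} (hs : s ≤ T) :
    (volume.restrict (Ioo 0 s ×ˢ univ) : Measure (ℝ × Space d)) ≤ volume.restrict (slab d T) :=
  Measure.restrict_mono (prod_mono_left (Ioo_subset_Icc_self.trans (Icc_subset_Icc_right hs)))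
    le_rfl

lemma ae_toReal_smul_eq (hA3 : MarginalA3 T p) {s : ℝ} (hs : s ≤ T) (f : ℝ × Space d → ℝ) :
    (fun q => (ENNReal.ofReal (p q.1 q.2)).toReal • f q)
      =ᵐ[volume.restrict (Ioo 0 s ×ˢ univ)] fun q => p q.1 q.2 * f q := by
  filter_upwards [ae_mono (restrict_openSlab_le hs) hA3.nonneg_slab] with q hq
  rw [ENNReal.toReal_ofReal hq, smul_eq_mul]

lemma integral_openFlowMeasure (hA3 : MarginalA3 T p) {s : ℝ} (hs : s ≤ T)
    (f : ℝ × Space d → ℝ) :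
    ∫ q, f q ∂openFlowMeasure T p s = ∫ q in Ioo 0 s ×ˢ univ, p q.1 q.2 * f q := by
  rw [openFlowMeasure_eq hs, integral_withDensity_eq_integral_toReal_smul₀
    (hA3.aestronglyMeasurable.mono_measure (restrict_openSlab_le hs)).aemeasurable.ennreal_ofReal
    (ae_of_all _ fun _ => ENNReal.ofReal_lt_top)]
  exact integral_congr_ae (ae_toReal_smul_eq hA3 hs f)

lemma integrable_openFlowMeasure_iff (hA3 : MarginalA3 T p) {s : ℝ} (hs : s ≤ T)
    (f : ℝ × Space d → ℝ) :
    Integrable f (openFlowMeasure T p s)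
      ↔ IntegrableOn (fun q => p q.1 q.2 * f q) (Ioo 0 s ×ˢ univ) := by
  rw [openFlowMeasure_eq hs, integrable_withDensity_iff_integrable_smul₀'
    (hA3.aestronglyMeasurable.mono_measure (restrict_openSlab_le hs)).aemeasurable.ennreal_ofReal
    (ae_of_all _ fun _ => ENNReal.ofReal_lt_top)]
  exact integrable_congr (ae_toReal_smul_eq hA3 hs f)

lemma openSlab_ae_eq_slab :
    (Ioo 0 T ×ˢ univ : Set (ℝ × Space d)) =ᵐ[volume] slab d T := by
  rw [slab, Measure.volume_eq_prod]
  exact Measure.set_prod_ae_eq Ioo_ae_eq_Icc (ae_eq_refl _)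

lemma intervalIntegral_openFlowMeasure (hA3 : MarginalA3 T p) {s : ℝ} (hs : s ∈ Icc 0 T)
    {f : ℝ × Space d → ℝ} (hf : Integrable f (openFlowMeasure T p s)) :
    ∫ r in (0 : ℝ)..s, ∫ y, p r y * f (r, y) = ∫ q, f q ∂openFlowMeasure T p s := by
  rw [integral_openFlowMeasure hA3 hs.2, intervalIntegral.integral_of_le hs.1,
    integral_Ioc_eq_integral_Ioo]
  rw [integrable_openFlowMeasure_iff hA3 hs.2, Measure.volume_eq_prod] at hf
  rw [Measure.volume_eq_prod, setIntegral_prod _ hf]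
  simp

lemma integral_marginalMeasure (hA3 : MarginalA3 T p) {t : ℝ} (ht : t ∈ Icc 0 T)
    (f : Space d → ℝ) : ∫ x, f x ∂marginalMeasure p t = ∫ x, p t x * f x := by
  rw [marginalMeasure, integral_withDensity_eq_integral_toReal_smul₀
    (hA3.integrable t ht).1.aemeasurable.ennreal_ofReal
    (ae_of_all _ fun _ => ENNReal.ofReal_lt_top)]
  refine integral_congr_ae ?_
  filter_upwards [hA3.nonneg t ht] with x hx
  rw [ENNReal.toReal_ofReal hx, smul_eq_mul]

end FlowMeasure

/-! ### The weak residual -/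

section WeakResidual

variable {d : ℕ} {T : ℝ} {p : ℝ → Space d → ℝ} {u : ℝ → Space d → Space d}

/-- The residual of the weak continuity equation on `[0,s]`, tested against `φ`:
`∫_{(0,s) × ℝ^d} 𝒜^u φ p dt dx - ∫ φ(s,·) p(s,·) dx + ∫ φ(0,·) p(0,·) dx`. The operator `𝒜^u` is
written as the derivative in the direction `(1, u)`. -/
noncomputable def weakResidual (T : ℝ) (p : ℝ → Space d → ℝ) (u : ℝ → Space d → Space d) (s : ℝ)
    (φ : ℝ × Space d → ℝ) : ℝ :=
  ∫ q, fderiv ℝ φ q (spaceTimeVelocity u q) ∂openFlowMeasure T p s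
    - ∫ x, φ (s, x) ∂marginalMeasure p s + ∫ x, φ (0, x) ∂marginalMeasure p 0

lemma genA_eq_fderiv {φ : ℝ × Space d → ℝ} {q : ℝ × Space d} (h : DifferentiableAt ℝ φ q) :
    genA u φ q.1 q.2 = fderiv ℝ φ q (spaceTimeVelocity u q) := by
  have h1 : HasDerivAt (fun t => φ (t, q.2)) (fderiv ℝ φ q (1, 0)) q.1 :=
    HasFDerivAt.comp_hasDerivAt (f := fun t => (t, q.2)) (l := φ) q.1 h.hasFDerivAt
      ((hasDerivAt_id q.1).prodMk (hasDerivAt_const q.1 q.2))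
  have h2 : HasFDerivAt (fun x => φ (q.1, x))
      ((fderiv ℝ φ q).comp (ContinuousLinearMap.inr ℝ ℝ (Space d))) q.2 :=
    HasFDerivAt.comp (f := fun x => (q.1, x)) (g := φ) q.2 h.hasFDerivAt
      (hasFDerivAt_prodMk_right q.1 q.2)
  rw [genA, h1.deriv, real_inner_comm, inner_gradient_left, h2.fderiv,
    ContinuousLinearMap.comp_apply, ContinuousLinearMap.inr_apply, ← map_add, spaceTimeVelocity]
  simp

lemma openSlab_mem_nhds {q : ℝ × Space d} (hq : q ∈ Ioo 0 T ×ˢ (univ : Set (Space d))) :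
    slab d T ∈ 𝓝 q :=
  mem_of_superset ((isOpen_Ioo.prod isOpen_univ).mem_nhds hq)
    (prod_mono_left Ioo_subset_Icc_self)

lemma IsCb1.differentiableAt {φ : ℝ × Space d → ℝ} (hφ : IsCb1 T φ) {q : ℝ × Space d}
    (hq : q ∈ Ioo 0 T ×ˢ (univ : Set (Space d))) : DifferentiableAt ℝ φ q :=
  (hφ.1.contDiffAt (openSlab_mem_nhds hq)).differentiableAt one_ne_zero

lemma IsCb1.exists_bound {φ : ℝ × Space d → ℝ} (hφ : IsCb1 T φ) :
    ∃ C, 0 ≤ C ∧ (∀ q ∈ slab d T, |φ q| ≤ C) ∧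
      ∀ q ∈ Ioo 0 T ×ˢ (univ : Set (Space d)), ‖fderiv ℝ φ q‖ ≤ C := by
  obtain ⟨C, hC⟩ := hφ.2
  refine ⟨max C 0, le_max_right _ _, fun q hq => (hC q hq).1.trans (le_max_left _ _),
    fun q hq => ?_⟩
  rw [← fderivWithin_of_mem_nhds (openSlab_mem_nhds hq)]
  exact (hC q (prod_mono_left Ioo_subset_Icc_self hq)).2.trans (le_max_left _ _)

lemma isCb1_of_contDiff (hT : 0 < T) {φ : ℝ × Space d → ℝ} (hφ : ContDiff ℝ 1 φ) {C : ℝ}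
    (hC : ∀ q ∈ slab d T, |φ q| ≤ C ∧ ‖fderiv ℝ φ q‖ ≤ C) : IsCb1 T φ := by
  refine ⟨hφ.contDiffOn, C, fun q hq => ⟨(hC q hq).1, ?_⟩⟩
  rw [((hφ.differentiable one_ne_zero) q).fderivWithin]
  · exact (hC q hq).2
  · exact ((uniqueDiffOn_Icc hT).prod uniqueDiffOn_univ) q hq

lemma IsCb1.continuous_right {φ : ℝ × Space d → ℝ} (hφ : IsCb1 T φ) {t : ℝ} (ht : t ∈ Icc 0 T) :
    Continuous fun x => φ (t, x) :=
  hφ.1.continuousOn.comp_continuous (by fun_prop) fun x => ⟨ht, mem_univ x⟩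

lemma aestronglyMeasurable_fderiv_apply (hA3 : MarginalA3 T p) (hu : VelocityL1 T p u) (s : ℝ)
    (φ : ℝ × Space d → ℝ) :
    AEStronglyMeasurable (fun q => fderiv ℝ φ q (spaceTimeVelocity u q))
      (openFlowMeasure T p s) :=
  isBoundedBilinearMap_apply.continuous.comp_aestronglyMeasurable₂
    (measurable_fderiv ℝ φ).aestronglyMeasurable (integrable_spaceTimeVelocity hA3 hu s).1

lemma ae_norm_fderiv_apply_le {s : ℝ} (hs : s ≤ T) {φ : ℝ × Space d → ℝ} {C : ℝ}
    (hC : ∀ q ∈ Ioo 0 T ×ˢ (univ : Set (Space d)), ‖fderiv ℝ φ q‖ ≤ C) :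
    ∀ᵐ q ∂openFlowMeasure T p s,
      ‖fderiv ℝ φ q (spaceTimeVelocity u q)‖ ≤ C * ‖spaceTimeVelocity u q‖ := by
  filter_upwards [ae_openFlowMeasure_mem s] with q hq
  refine (ContinuousLinearMap.le_opNorm _ _).trans ?_
  have := hC q (prod_mono_left (Ioo_subset_Ioo_right hs) hq)
  gcongr

lemma integrable_fderiv_apply (hA3 : MarginalA3 T p) (hu : VelocityL1 T p u) {s : ℝ} (hs : s ≤ T)
    {φ : ℝ × Space d → ℝ} (hφ : IsCb1 T φ) :
    Integrable (fun q => fderiv ℝ φ q (spaceTimeVelocity u q)) (openFlowMeasure T p s) := by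
  obtain ⟨C, -, -, hC⟩ := hφ.exists_bound
  exact ((integrable_spaceTimeVelocity hA3 hu s).norm.const_mul C).mono'
    (aestronglyMeasurable_fderiv_apply hA3 hu s φ) (ae_norm_fderiv_apply_le hs hC)

lemma integrable_marginal (hA3 : MarginalA3 T p) {t : ℝ} (ht : t ∈ Icc 0 T)
    {φ : ℝ × Space d → ℝ} (hφ : IsCb1 T φ) :
    Integrable (fun x => φ (t, x)) (marginalMeasure p t) := by
  obtain ⟨C, -, hC, -⟩ := hφ.exists_bound
  have := hA3.isFiniteMeasure_marginalMeasure ht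
  exact Integrable.of_bound (hφ.continuous_right ht).aestronglyMeasurable C
    (ae_of_all _ fun x => hC (t, x) ⟨ht, mem_univ x⟩)

lemma ae_genA_eq_fderiv {s : ℝ} (hs : s ≤ T) {φ : ℝ × Space d → ℝ} (hφ : IsCb1 T φ) :
    (fun q : ℝ × Space d => genA u φ q.1 q.2)
      =ᵐ[openFlowMeasure T p s] fun q => fderiv ℝ φ q (spaceTimeVelocity u q) := by
  filter_upwards [ae_openFlowMeasure_mem s] with q hq
  exact genA_eq_fderiv (hφ.differentiableAt (prod_mono_left (Ioo_subset_Ioo_right hs) hq))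

/-- The weak residual, written with iterated integrals. -/
lemma weakResidual_eq (hA3 : MarginalA3 T p) (hu : VelocityL1 T p u) {s : ℝ} (hs : s ∈ Icc 0 T)
    {φ : ℝ × Space d → ℝ} (hφ : IsCb1 T φ) :
    weakResidual T p u s φ = (∫ r in (0 : ℝ)..s, ∫ y, p r y * genA u φ r y)
      - (∫ y, p s y * φ (s, y)) + ∫ y, p 0 y * φ (0, y) := by
  have h0 : (0 : ℝ) ∈ Icc 0 T := ⟨le_rfl, hs.1.trans hs.2⟩
  have h := ae_genA_eq_fderiv (p := p) (u := u) hs.2 hφ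
  rw [weakResidual, integral_marginalMeasure hA3 hs, integral_marginalMeasure hA3 h0,
    ← integral_congr_ae h, ← intervalIntegral_openFlowMeasure hA3 hs
      ((integrable_fderiv_apply hA3 hu hs.2 hφ).congr h.symm)
      (f := fun q => genA u φ q.1 q.2)]

lemma abs_weakResidual_le (hA3 : MarginalA3 T p) (hu : VelocityL1 T p u) {s : ℝ}
    (hs : s ∈ Icc 0 T) {φ : ℝ × Space d → ℝ} {C₀ C₁ : ℝ} (hC₀ : ∀ q, |φ q| ≤ C₀)
    (hC₁ : ∀ q, ‖fderiv ℝ φ q‖ ≤ C₁) :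
    |weakResidual T p u s φ| ≤ C₁ * (∫ q, ‖spaceTimeVelocity u q‖ ∂openFlowMeasure T p s)
      + C₀ * ((marginalMeasure p s).real univ + (marginalMeasure p 0).real univ) := by
  have h0 : (0 : ℝ) ∈ Icc 0 T := ⟨le_rfl, hs.1.trans hs.2⟩
  have h1 : ‖∫ q, fderiv ℝ φ q (spaceTimeVelocity u q) ∂openFlowMeasure T p s‖
      ≤ C₁ * ∫ q, ‖spaceTimeVelocity u q‖ ∂openFlowMeasure T p s := by
    rw [← integral_const_mul]
    exact norm_integral_le_of_norm_le ((integrable_spaceTimeVelocity hA3 hu s).norm.const_mul _)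
      (ae_norm_fderiv_apply_le hs.2 fun q _ => hC₁ q)
  have h2 : ∀ t ∈ Icc 0 T,
      ‖∫ x, φ (t, x) ∂marginalMeasure p t‖ ≤ C₀ * (marginalMeasure p t).real univ := by
    intro t ht
    have := hA3.isFiniteMeasure_marginalMeasure ht
    exact norm_integral_le_of_norm_le_const (ae_of_all _ fun x => hC₀ _)
  rw [weakResidual, ← Real.norm_eq_abs, mul_add, ← add_assoc]
  exact (norm_add_le _ _).trans (add_le_add ((norm_sub_le _ _).trans (add_le_add h1 (h2 s hs)))
    (h2 0 h0))

lemma weakResidual_add (hA3 : MarginalA3 T p) (hu : VelocityL1 T p u) {s : ℝ}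
    (hs : s ∈ Icc 0 T) {φ ψ : ℝ × Space d → ℝ} (hφ : IsCb1 T φ) (hψ : IsCb1 T ψ) :
    weakResidual T p u s (φ + ψ) = weakResidual T p u s φ + weakResidual T p u s ψ := by
  have h0 : (0 : ℝ) ∈ Icc 0 T := ⟨le_rfl, hs.1.trans hs.2⟩
  have h : (fun q => fderiv ℝ (φ + ψ) q (spaceTimeVelocity u q)) =ᵐ[openFlowMeasure T p s]
      fun q => fderiv ℝ φ q (spaceTimeVelocity u q) + fderiv ℝ ψ q (spaceTimeVelocity u q) := by
    filter_upwards [ae_openFlowMeasure_mem s] with q hq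
    have hq' := prod_mono_left (Ioo_subset_Ioo_right hs.2) hq
    rw [fderiv_add (hφ.differentiableAt hq') (hψ.differentiableAt hq')]
    rfl
  simp only [weakResidual, Pi.add_apply]
  rw [integral_congr_ae h, integral_add (integrable_fderiv_apply hA3 hu hs.2 hφ)
    (integrable_fderiv_apply hA3 hu hs.2 hψ), integral_add (integrable_marginal hA3 hs hφ)
    (integrable_marginal hA3 hs hψ), integral_add (integrable_marginal hA3 h0 hφ)
    (integrable_marginal hA3 h0 hψ)]
  ring

lemma weakResidual_const_smul (c : ℝ) (s : ℝ) (φ : ℝ × Space d → ℝ) :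
    weakResidual T p u s (c • φ) = c * weakResidual T p u s φ := by
  simp only [weakResidual, fderiv_const_smul_field, Pi.smul_apply, smul_apply, smul_eq_mul,
    integral_const_mul]
  ring

/-- The weak residual is continuous for bounded pointwise convergence of the test functions and
of their derivatives. -/
lemma tendsto_weakResidual (hA3 : MarginalA3 T p) (hu : VelocityL1 T p u) {s : ℝ}
    (hs : s ∈ Icc 0 T) {φ : ℝ × Space d → ℝ} {φn : ℕ → ℝ × Space d → ℝ} {C : ℝ}
    (hcont : ∀ n, ContinuousOn (φn n) (slab d T))
    (hC₀ : ∀ n, ∀ q ∈ slab d T, |φn n q| ≤ C)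
    (hC₁ : ∀ n, ∀ q ∈ Ioo 0 T ×ˢ (univ : Set (Space d)), ‖fderiv ℝ (φn n) q‖ ≤ C)
    (hlim₀ : ∀ q ∈ slab d T, Tendsto (fun n => φn n q) atTop (𝓝 (φ q)))
    (hlim₁ : ∀ q ∈ Ioo 0 T ×ˢ (univ : Set (Space d)),
      Tendsto (fun n => fderiv ℝ (φn n) q) atTop (𝓝 (fderiv ℝ φ q))) :
    Tendsto (fun n => weakResidual T p u s (φn n)) atTop (𝓝 (weakResidual T p u s φ)) := by
  have h0 : (0 : ℝ) ∈ Icc 0 T := ⟨le_rfl, hs.1.trans hs.2⟩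
  have hmarg : ∀ t ∈ Icc 0 T, Tendsto (fun n => ∫ x, φn n (t, x) ∂marginalMeasure p t) atTop
      (𝓝 (∫ x, φ (t, x) ∂marginalMeasure p t)) := by
    intro t ht
    have := hA3.isFiniteMeasure_marginalMeasure ht
    refine tendsto_integral_of_dominated_convergence (fun _ => C) (fun n => ?_)
      (integrable_const _) (fun n => ae_of_all _ fun x => hC₀ n (t, x) ⟨ht, mem_univ x⟩)
      (ae_of_all _ fun x => hlim₀ (t, x) ⟨ht, mem_univ x⟩)
    exact ((hcont n).comp_continuous (by fun_prop) fun x =>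
      ⟨ht, mem_univ x⟩).aestronglyMeasurable
  refine ((tendsto_integral_of_dominated_convergence (fun q => C * ‖spaceTimeVelocity u q‖)
    (fun n => aestronglyMeasurable_fderiv_apply hA3 hu s (φn n))
    ((integrable_spaceTimeVelocity hA3 hu s).norm.const_mul C)
    (fun n => ae_norm_fderiv_apply_le hs.2 (hC₁ n)) ?_).sub (hmarg s hs)).add (hmarg 0 h0)
  filter_upwards [ae_openFlowMeasure_mem s] with q hq
  exact ((ContinuousLinearMap.apply ℝ ℝ (spaceTimeVelocity u q)).continuous.tendsto _).comp
    (hlim₁ q (prod_mono_left (Ioo_subset_Ioo_right hs.2) hq))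

end WeakResidual

/-! ### The residual as an element of the reproducing kernel Hilbert space -/

section Membership

variable {d : ℕ} {T : ℝ} {p : ℝ → Space d → ℝ} {u : ℝ → Space d → Space d}
  {K : SpaceTime d → ℝ} {𝓗 : Type*} [NormedAddCommGroup 𝓗]
  [InnerProductSpace ℝ 𝓗] [CompleteSpace 𝓗] [RKHS ℝ 𝓗 (SpaceTime d) ℝ]

/-- The identity `ℝ × ℝ^d → ℝ^{d+1}`, from the product norm to the Euclidean norm. -/
noncomputable def toSpaceTime (d : ℕ) : (ℝ × Space d) ≃L[ℝ] SpaceTime d :=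
  (WithLp.prodContinuousLinearEquiv 2 ℝ ℝ (Space d)).symm

lemma toSpaceTime_apply (q : ℝ × Space d) : toSpaceTime d q = WithLp.toLp 2 q := rfl

lemma kernelSection_eq_comp (h𝓗 : IsRKHSOf K 𝓗) (ξ : SpaceTime d) :
    kernelSection K ξ = RKHS.kerFun 𝓗 ξ (1 : ℝ) ∘ toSpaceTime d := by
  ext q
  rw [Function.comp_apply, h𝓗.kerFun_apply, toSpaceTime_apply, kernelSection, ← h𝓗.kernel_neg,
    neg_sub]

lemma IsRKHSOf.contDiff_kerFun (h𝓗 : IsRKHSOf K 𝓗) (hA1 : KernelA1 K) (hA2 : KernelA2 K)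
    (ξ : SpaceTime d) : ContDiff ℝ 1 (RKHS.kerFun 𝓗 ξ (1 : ℝ)) := by
  have h : ⇑(RKHS.kerFun 𝓗 ξ (1 : ℝ)) = fun η => K (η - ξ) := funext fun η => h𝓗.kerFun_apply η ξ
  rw [h]
  exact (contDiff_kernel hA1 hA2).comp (contDiff_id.sub contDiff_const)

/-- Elements of the reproducing kernel Hilbert space, and their derivatives, are uniformly
controlled by their norm. -/
lemma IsRKHSOf.exists_comp_bound (h𝓗 : IsRKHSOf K 𝓗) (hA1 : KernelA1 K) (hA2 : KernelA2 K) :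
    ∃ C : ℝ, ∀ (f : 𝓗) (q : ℝ × Space d), |(f ∘ toSpaceTime d) q| ≤ C * ‖f‖ ∧
      ‖fderiv ℝ (f ∘ toSpaceTime d) q‖ ≤ C * ‖f‖ := by
  obtain ⟨L, hL, h⟩ := h𝓗.exists_lipschitz hA1 hA2
  set M := ‖(toSpaceTime d : (ℝ × Space d) →L[ℝ] SpaceTime d)‖
  refine ⟨max √(K 0) (L * M), fun f q => ⟨?_, ?_⟩⟩
  · refine (h𝓗.abs_apply_le f _).trans ?_
    gcongr
    exact le_max_left _ _
  · refine (norm_fderiv_le_of_abs_sub_le (C := L * M * ‖f‖) (by positivity) (fun x y => ?_)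
      q).trans ?_
    · refine (h f _ _).trans ?_
      rw [← map_sub]
      have : ‖toSpaceTime d (x - y)‖ ≤ M * ‖x - y‖ :=
        (toSpaceTime d : (ℝ × Space d) →L[ℝ] SpaceTime d).le_opNorm _
      calc L * ‖f‖ * ‖toSpaceTime d (x - y)‖ ≤ L * ‖f‖ * (M * ‖x - y‖) := by gcongr
        _ = L * M * ‖f‖ * ‖x - y‖ := by ring
    · gcongr
      exact le_max_right _ _

lemma IsRKHSOf.isCb1_comp (h𝓗 : IsRKHSOf K 𝓗) (hA1 : KernelA1 K) (hA2 : KernelA2 K) (hT : 0 < T)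
    {f : 𝓗} (hf : ContDiff ℝ 1 f) : IsCb1 T (f ∘ toSpaceTime d) := by
  obtain ⟨C, hC⟩ := h𝓗.exists_comp_bound hA1 hA2
  exact isCb1_of_contDiff hT (hf.comp (toSpaceTime d).contDiff) fun q _ => hC f q

lemma IsRKHSOf.isCb1_kernelSection (h𝓗 : IsRKHSOf K 𝓗) (hA1 : KernelA1 K) (hA2 : KernelA2 K)
    (hT : 0 < T) (ξ : SpaceTime d) : IsCb1 T (kernelSection K ξ) := by
  rw [kernelSection_eq_comp h𝓗]
  exact h𝓗.isCb1_comp hA1 hA2 hT (h𝓗.contDiff_kerFun hA1 hA2 ξ)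

lemma kernelResidual_eq_weakResidual (h𝓗 : IsRKHSOf K 𝓗) (hA1 : KernelA1 K) (hA2 : KernelA2 K)
    (hA3 : MarginalA3 T p) (hu : VelocityL1 T p u) (hT : 0 < T) {s : ℝ} (hs : s ∈ Icc 0 T)
    (ξ : SpaceTime d) : kernelResidual K p u s ξ = weakResidual T p u s (kernelSection K ξ) := by
  rw [weakResidual_eq hA3 hu hs (h𝓗.isCb1_kernelSection hA1 hA2 hT ξ), kernelResidual]

variable (𝓗) in
/-- The continuously differentiable elements of the reproducing kernel Hilbert space. -/
def differentiableElements : Submodule ℝ 𝓗 where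
  carrier := {f | ContDiff ℝ 1 f}
  zero_mem' := by
    simp only [mem_ofPred_eq, RKHS.coe_zero]
    exact contDiff_const
  add_mem' := fun hf hg => by
    simp only [mem_ofPred_eq, RKHS.coe_add]
    exact ContDiff.add hf hg
  smul_mem' := fun c f hf => by
    simp only [mem_ofPred_eq, RKHS.coe_smul]
    exact contDiff_const.smul hf

/-- The residual belongs to the reproducing kernel Hilbert space: the weak residual is a bounded
linear functional on the continuously differentiable elements; extend it by Hahn-Banach, and
represent the extension by an element, whose value at `ξ` is the weak residual of the kernel
section at `ξ`. -/
lemma exists_coe_eq_kernelResidual (h𝓗 : IsRKHSOf K 𝓗) (hA1 : KernelA1 K) (hA2 : KernelA2 K)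
    (hA3 : MarginalA3 T p) (hu : VelocityL1 T p u) (hT : 0 < T) {s : ℝ} (hs : s ∈ Icc 0 T) :
    ∃ h : 𝓗, (h : SpaceTime d → ℝ) = kernelResidual K p u s := by
  obtain ⟨C, hC⟩ := h𝓗.exists_comp_bound hA1 hA2
  let Λ : differentiableElements 𝓗 →ₗ[ℝ] ℝ :=
    { toFun := fun f => weakResidual T p u s ((f : 𝓗) ∘ toSpaceTime d)
      map_add' := fun f g => by
        rw [← weakResidual_add hA3 hu hs (h𝓗.isCb1_comp hA1 hA2 hT f.2)
          (h𝓗.isCb1_comp hA1 hA2 hT g.2), Submodule.coe_add, RKHS.coe_add]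
        rfl
      map_smul' := fun c f => by
        rw [RingHom.id_apply, smul_eq_mul, ← weakResidual_const_smul, Submodule.coe_smul,
          RKHS.coe_smul]
        rfl }
  let Λc : StrongDual ℝ (differentiableElements 𝓗) := Λ.mkContinuous
    (C * (∫ q, ‖spaceTimeVelocity u q‖ ∂openFlowMeasure T p s)
      + C * ((marginalMeasure p s).real univ + (marginalMeasure p 0).real univ)) fun f => by
    refine (abs_weakResidual_le hA3 hu hs (fun q => (hC f q).1) fun q => (hC f q).2).trans
      (le_of_eq ?_)
    rw [Submodule.coe_norm]
    ring
  obtain ⟨g, hg, -⟩ := exists_extension_norm_eq (differentiableElements 𝓗) Λc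
  refine ⟨(InnerProductSpace.toDual ℝ 𝓗).symm g, funext fun ξ => ?_⟩
  rw [apply_eq_inner_kerFun, InnerProductSpace.toDual_symm_apply,
    kernelResidual_eq_weakResidual h𝓗 hA1 hA2 hA3 hu hT hs, kernelSection_eq_comp h𝓗]
  exact hg ⟨RKHS.kerFun 𝓗 ξ (1 : ℝ), h𝓗.contDiff_kerFun hA1 hA2 ξ⟩

end Membership

/-! ### Vanishing on smooth functions of compact support -/

section Vanishing

variable {d : ℕ} {T : ℝ} {p : ℝ → Space d → ℝ} {u : ℝ → Space d → Space d}

lemma transportFunctional_ofReal_eq_weakResidual (s : ℝ) {F : SpaceTime d → ℝ}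
    (hF : Differentiable ℝ F) :
    transportFunctional (openFlowMeasure T p s) (toSpaceTime d)
      (fun q => toSpaceTime d (spaceTimeVelocity u q)) (marginalMeasure p s) (marginalMeasure p 0)
      (fun x => toSpaceTime d (s, x)) (fun x => toSpaceTime d (0, x)) (fun η => (F η : ℂ))
      = (weakResidual T p u s (F ∘ toSpaceTime d) : ℝ) := by
  have h : ∀ q v, fderiv ℝ (fun η => (F η : ℂ)) (toSpaceTime d q) (toSpaceTime d v)
      = (fderiv ℝ (F ∘ toSpaceTime d) q v : ℝ) := by
    intro q v
    have h1 : HasFDerivAt (fun η => (F η : ℂ))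
        (Complex.ofRealCLM.comp (fderiv ℝ F (toSpaceTime d q))) (toSpaceTime d q) :=
      Complex.ofRealCLM.hasFDerivAt.comp _ (hF _).hasFDerivAt
    have h2 : HasFDerivAt (F ∘ toSpaceTime d)
        ((fderiv ℝ F (toSpaceTime d q)).comp (toSpaceTime d : (ℝ × Space d) →L[ℝ] SpaceTime d)) q :=
      (hF _).hasFDerivAt.comp q (toSpaceTime d).hasFDerivAt
    rw [h1.fderiv, h2.fderiv]
    rfl
  simp only [transportFunctional, h, weakResidual, integral_complex_ofReal, Function.comp_apply]
  push_cast
  rfl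

/-- A vanishing kernel residual forces the weak residual to vanish on test functions: its symbol
vanishes because the Fourier transform of the kernel has full support. -/
lemma weakResidual_eq_zero_of_smooth {K : SpaceTime d → ℝ} (hA1 : KernelA1 K) (hA2 : KernelA2 K)
    (hA3 : MarginalA3 T p) (hu : VelocityL1 T p u) {s : ℝ} (hs : s ∈ Icc 0 T)
    (h : ∀ ξ, weakResidual T p u s (kernelSection K ξ) = 0)
    {ψ : ℝ × Space d → ℝ} (hψ : ContDiff ℝ ∞ ψ) (hc : HasCompactSupport ψ) :
    weakResidual T p u s ψ = 0 := by
  have h0 : (0 : ℝ) ∈ Icc 0 T := ⟨le_rfl, hs.1.trans hs.2⟩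
  have := hA3.isFiniteMeasure_openFlowMeasure s
  have := hA3.isFiniteMeasure_marginalMeasure hs
  have := hA3.isFiniteMeasure_marginalMeasure h0
  have ha : AEMeasurable (toSpaceTime d) (openFlowMeasure T p s) :=
    (toSpaceTime d).continuous.measurable.aemeasurable
  have hw : Integrable (fun q => toSpaceTime d (spaceTimeVelocity u q)) (openFlowMeasure T p s) :=
    (toSpaceTime d : (ℝ × Space d) →L[ℝ] SpaceTime d).integrable_comp
      (integrable_spaceTimeVelocity hA3 hu s)
  have hb : ∀ t : ℝ, AEMeasurable (fun x => toSpaceTime d (t, x)) (marginalMeasure p t) := fun t =>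
    ((toSpaceTime d).continuous.comp (by fun_prop)).measurable.aemeasurable
  have hsym := transportSymbol_eq_zero ha hw (hb s) (hb 0) hA1.continuous_fourier
    (KernelA2.integrable_fourier hA1 hA2)
    (by simpa using KernelA2.integrable_pow_mul hA1 hA2 one_le_two) hA1.support_eq fun ξ => by
      rw [fourierInv_fourier_kernel hA1 hA2,
        transportFunctional_ofReal_eq_weakResidual s (F := fun η => K (ξ - η))]
      · exact_mod_cast h ξ
      · exact (((contDiff_kernel hA1 hA2).comp (contDiff_const.sub contDiff_id)).differentiable
          one_ne_zero)
  have hF : ContDiff ℝ ∞ (ψ ∘ (toSpaceTime d).symm) := hψ.comp (toSpaceTime d).symm.contDiff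
  have hFc : HasCompactSupport (ψ ∘ (toSpaceTime d).symm) :=
    hc.comp_homeomorph (toSpaceTime d).symm.toHomeomorph
  let f : SchwartzMap (SpaceTime d) ℂ :=
    (hFc.comp_left (g := ((↑) : ℝ → ℂ)) Complex.ofReal_zero).toSchwartzMap
      (Complex.ofRealCLM.contDiff.comp hF)
  have hf := transportFunctional_schwartz_eq_zero ha hw (hb s) (hb 0) hsym f
  have h2 := transportFunctional_ofReal_eq_weakResidual (T := T) (p := p) (u := u) s
    (hF.differentiable (by simp))
  have h3 : (ψ ∘ (toSpaceTime d).symm) ∘ toSpaceTime d = ψ := by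
    ext q
    simp
  rw [h3] at h2
  exact_mod_cast h2.symm.trans hf

end Vanishing

/-! ### From test functions to bounded `C¹` functions -/

section Approximation

/-- Mollification: a compactly supported `C¹` function is approximated by test functions,
uniformly together with its derivative. -/
lemma exists_smooth_approx {G : Type*} [NormedAddCommGroup G] [NormedSpace ℝ G]
    [FiniteDimensional ℝ G] [MeasureSpace G] [BorelSpace G]
    [(volume : Measure G).IsAddHaarMeasure]
    {ψ : G → ℝ} (hψ : ContDiff ℝ 1 ψ) (hc : HasCompactSupport ψ) {ε : ℝ} (hε : 0 < ε) :
    ∃ g : G → ℝ, ContDiff ℝ ∞ g ∧ HasCompactSupport g ∧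
      ∀ x, |g x - ψ x| ≤ ε ∧ ‖fderiv ℝ g x - fderiv ℝ ψ x‖ ≤ ε := by
  have hψ' : Continuous (fderiv ℝ ψ) := hψ.continuous_fderiv one_ne_zero
  obtain ⟨δ₀, hδ₀, h₀⟩ := Metric.uniformContinuous_iff.1
    (hc.uniformContinuous_of_continuous hψ.continuous) ε hε
  obtain ⟨δ₁, hδ₁, h₁⟩ := Metric.uniformContinuous_iff.1
    ((hc.fderiv ℝ).uniformContinuous_of_continuous hψ') ε hε
  have hδ : 0 < min δ₀ δ₁ := lt_min hδ₀ hδ₁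
  let b : ContDiffBump (0 : G) := ⟨min δ₀ δ₁ / 2, min δ₀ δ₁, half_pos hδ, half_lt_self hδ⟩
  have hb : LocallyIntegrable (b.normed volume) := b.integrable_normed.locallyIntegrable
  have hder : ∀ x, fderiv ℝ (convolution (b.normed volume) ψ (ContinuousLinearMap.lsmul ℝ ℝ)
      volume) x = convolution (b.normed volume) (fderiv ℝ ψ) (ContinuousLinearMap.lsmul ℝ ℝ)
      volume x := fun x =>
    (hc.hasFDerivAt_convolution_right (ContinuousLinearMap.lsmul ℝ ℝ) hb hψ x).fderiv
  refine ⟨convolution (b.normed volume) ψ (ContinuousLinearMap.lsmul ℝ ℝ) volume,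
    b.hasCompactSupport_normed.contDiff_convolution_left _ b.contDiff_normed
      hψ.continuous.locallyIntegrable,
    b.hasCompactSupport_normed.convolution _ hc, fun x => ⟨?_, ?_⟩⟩
  · exact b.dist_normed_convolution_le hψ.continuous.aestronglyMeasurable fun y hy =>
      (h₀ ((Metric.mem_ball.1 hy).trans_le (min_le_left _ _))).le
  · rw [hder, ← dist_eq_norm]
    exact b.dist_normed_convolution_le hψ'.aestronglyMeasurable fun y hy =>
      (h₁ ((Metric.mem_ball.1 hy).trans_le (min_le_right _ _))).le

variable {d : ℕ} {T : ℝ} {p : ℝ → Space d → ℝ} {u : ℝ → Space d → Space d} {s : ℝ}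

lemma weakResidual_eq_zero_of_hasCompactSupport (hA3 : MarginalA3 T p) (hu : VelocityL1 T p u)
    (hs : s ∈ Icc 0 T)
    (h : ∀ ψ : ℝ × Space d → ℝ, ContDiff ℝ ∞ ψ → HasCompactSupport ψ → weakResidual T p u s ψ = 0)
    {φ : ℝ × Space d → ℝ} (hφ : ContDiff ℝ 1 φ) (hc : HasCompactSupport φ) :
    weakResidual T p u s φ = 0 := by
  have : (volume : Measure (ℝ × Space d)).IsAddHaarMeasure := by
    rw [Measure.volume_eq_prod]; infer_instance
  have hpos : ∀ n : ℕ, (0 : ℝ) < 1 / (n + 1) := fun n => Nat.one_div_pos_of_nat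
  have hle : ∀ n : ℕ, (1 : ℝ) / (n + 1) ≤ 1 := fun n => by
    rw [div_le_one (by positivity)]; linarith [n.cast_nonneg (α := ℝ)]
  choose g hg hgc hgφ using fun n : ℕ => exists_smooth_approx hφ hc (hpos n)
  obtain ⟨A, hA⟩ := hc.exists_bound_of_continuous hφ.continuous
  obtain ⟨B, hB⟩ := (hc.fderiv ℝ).exists_bound_of_continuous (hφ.continuous_fderiv one_ne_zero)
  have hlim : Tendsto (fun n => weakResidual T p u s (g n)) atTop
      (𝓝 (weakResidual T p u s φ)) := by
    refine tendsto_weakResidual hA3 hu hs (C := 1 + max A B)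
      (fun n => (hg n).continuous.continuousOn) (fun n q _ => ?_) (fun n q _ => ?_)
      (fun q _ => ?_) (fun q _ => ?_)
    · have h1 := norm_add_le (g n q - φ q) (φ q)
      rw [sub_add_cancel] at h1
      exact h1.trans (add_le_add (((hgφ n q).1).trans (hle n)) ((hA q).trans (le_max_left _ _)))
    · have h1 := norm_add_le (fderiv ℝ (g n) q - fderiv ℝ φ q) (fderiv ℝ φ q)
      rw [sub_add_cancel] at h1
      exact h1.trans (add_le_add (((hgφ n q).2).trans (hle n)) ((hB q).trans (le_max_right _ _)))
    · rw [tendsto_iff_norm_sub_tendsto_zero]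
      exact squeeze_zero (fun n => norm_nonneg _) (fun n => (hgφ n q).1)
        tendsto_one_div_add_atTop_nhds_zero_nat
    · rw [tendsto_iff_norm_sub_tendsto_zero]
      exact squeeze_zero (fun n => norm_nonneg _) (fun n => (hgφ n q).2)
        tendsto_one_div_add_atTop_nhds_zero_nat
  simp only [h _ (hg _) (hgc _)] at hlim
  exact tendsto_nhds_unique hlim tendsto_const_nhds

/-- Truncation: functions that are `C¹` on the whole space are reached by multiplication with the
cutoffs `χ (· / (n + 1))`, which are eventually equal to one near any given point. -/
lemma weakResidual_eq_zero_of_contDiff (hA3 : MarginalA3 T p) (hu : VelocityL1 T p u)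
    (hs : s ∈ Icc 0 T)
    (h : ∀ ψ : ℝ × Space d → ℝ, ContDiff ℝ ∞ ψ → HasCompactSupport ψ → weakResidual T p u s ψ = 0)
    {φ : ℝ × Space d → ℝ} (hφ : ContDiff ℝ 1 φ) {C : ℝ} (hC₀ : ∀ q ∈ slab d T, |φ q| ≤ C)
    (hC₁ : ∀ q ∈ Ioo 0 T ×ˢ (univ : Set (Space d)), ‖fderiv ℝ φ q‖ ≤ C) :
    weakResidual T p u s φ = 0 := by
  let χ : ContDiffBump (0 : ℝ × Space d) := ⟨1, 2, one_pos, one_lt_two⟩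
  have hχ : ContDiff ℝ 1 χ := χ.contDiff
  obtain ⟨B, hB⟩ := (χ.hasCompactSupport.fderiv ℝ).exists_bound_of_continuous
    (hχ.continuous_fderiv one_ne_zero)
  let a : ℕ → ℝ := fun n => ((n : ℝ) + 1)⁻¹
  have ha : ∀ n, 0 < a n := fun n => by positivity
  have ha1 : ∀ n, a n ≤ 1 := fun n => inv_le_one_of_one_le₀ (by linarith [n.cast_nonneg (α := ℝ)])
  have hlima : Tendsto a atTop (𝓝 0) := by
    simpa only [one_div] using tendsto_one_div_add_atTop_nhds_zero_nat (𝕜 := ℝ)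
  let χn : ℕ → ℝ × Space d → ℝ := fun n q => χ (a n • q)
  have hχn : ∀ n, ContDiff ℝ 1 (χn n) := fun n => hχ.comp (contDiff_const_smul _)
  have hχn' : ∀ n q, ‖fderiv ℝ (χn n) q‖ ≤ B := by
    intro n q
    have h1 : fderiv ℝ (χn n) q = a n • fderiv ℝ χ (a n • q) := fderiv_comp_smul _
    rw [h1, norm_smul, Real.norm_of_nonneg (ha n).le]
    exact (mul_le_of_le_one_left (norm_nonneg _) (ha1 n)).trans (hB _)
  have hχc : ∀ n, HasCompactSupport (χn n) := fun n =>
    χ.hasCompactSupport.comp_smul (ha n).ne'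
  have hev : ∀ q, ∀ᶠ n in atTop, (fun q => χn n q * φ q) =ᶠ[𝓝 q] φ := by
    intro q
    have h1 : Tendsto (fun n => a n • q) atTop (𝓝 0) := by
      simpa using hlima.smul_const q
    filter_upwards [h1 (Metric.ball_mem_nhds (0 : ℝ × Space d) one_pos)] with n hn
    have h2 : {q : ℝ × Space d | a n • q ∈ Metric.ball 0 1} ∈ 𝓝 q :=
      ((Metric.isOpen_ball.preimage (continuous_const_smul (a n))).mem_nhds hn)
    filter_upwards [h2] with q' hq'
    have : χ (a n • q') = 1 := χ.one_of_mem_closedBall (Metric.ball_subset_closedBall hq')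
    simp only [χn, this, one_mul]
  have hlim : Tendsto (fun n => weakResidual T p u s fun q => χn n q * φ q) atTop
      (𝓝 (weakResidual T p u s φ)) := by
    refine tendsto_weakResidual hA3 hu hs (C := C + B * C)
      (fun n => ((hχn n).mul hφ).continuous.continuousOn) (fun n q hq => ?_) (fun n q hq => ?_)
      (fun q _ => ?_) (fun q _ => ?_)
    · have hB0 : 0 ≤ B := (norm_nonneg _).trans (hB 0)
      have hC : 0 ≤ C := (abs_nonneg _).trans (hC₀ q hq)
      have h1 : |χn n q| ≤ 1 := by
        rw [abs_of_nonneg χ.nonneg]; exact χ.le_one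
      rw [abs_mul]
      have h2 := mul_le_mul h1 (hC₀ q hq) (abs_nonneg _) zero_le_one
      nlinarith
    · have hq' : q ∈ slab d T := prod_mono_left Ioo_subset_Icc_self hq
      have h1 : ‖χn n q‖ ≤ 1 := by
        rw [Real.norm_of_nonneg χ.nonneg]; exact χ.le_one
      rw [fderiv_fun_mul ((hχn n).differentiable one_ne_zero q)
        (hφ.differentiable one_ne_zero q)]
      refine (norm_add_le _ _).trans (add_le_add ?_ ?_)
      · rw [norm_smul]
        exact (mul_le_of_le_one_left (norm_nonneg _) h1).trans (hC₁ q hq)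
      · rw [norm_smul, mul_comm]
        exact mul_le_mul (hχn' n q) (hC₀ q hq') (norm_nonneg _)
          ((norm_nonneg _).trans (hχn' n q))
    · exact tendsto_nhds_of_eventually_eq ((hev q).mono fun n hn => hn.self_of_nhds)
    · exact tendsto_nhds_of_eventually_eq ((hev q).mono fun n hn => hn.fderiv_eq)
  have hz : ∀ n, weakResidual T p u s (fun q => χn n q * φ q) = 0 := fun n =>
    weakResidual_eq_zero_of_hasCompactSupport hA3 hu hs h ((hχn n).mul hφ)
      ((hχc n).mul_right)
  simp only [hz] at hlim
  exact tendsto_nhds_unique hlim tendsto_const_nhds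

/-- The contraction of the time axis by the factor `1 - 1 / (n + 2)` about the midpoint `T / 2`,
acting on space-time. -/
noncomputable def timeContraction (d : ℕ) (T : ℝ) (n : ℕ) (q : ℝ × Space d) : ℝ × Space d :=
  (T / 2 + (1 - 1 / ((n : ℝ) + 2)) * (q.1 - T / 2), q.2)

lemma one_div_nat_add_two_mem (n : ℕ) : (1 : ℝ) / (n + 2) ∈ Ioo 0 1 := by
  refine ⟨by positivity, ?_⟩
  rw [div_lt_one (by positivity)]
  linarith [n.cast_nonneg (α := ℝ)]

lemma tendsto_one_div_nat_add_two :
    Tendsto (fun n : ℕ => (1 : ℝ) / ((n : ℝ) + 2)) atTop (𝓝 0) :=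
  tendsto_const_nhds.div_atTop (tendsto_atTop_add_const_right _ _ tendsto_natCast_atTop_atTop)

lemma contDiff_timeContraction (n : ℕ) : ContDiff ℝ 1 (timeContraction d T n) := by
  unfold timeContraction
  fun_prop

lemma tendsto_timeContraction (q : ℝ × Space d) :
    Tendsto (fun n => timeContraction d T n q) atTop (𝓝 q) := by
  have h1 := tendsto_one_div_nat_add_two
  have h2 : Tendsto (fun n : ℕ => T / 2 + (1 - 1 / ((n : ℝ) + 2)) * (q.1 - T / 2)) atTop
      (𝓝 (T / 2 + (1 - 0) * (q.1 - T / 2))) :=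
    ((h1.const_sub 1).mul_const _).const_add _
  rw [sub_zero, one_mul, add_sub_cancel] at h2
  exact h2.prodMk_nhds tendsto_const_nhds

lemma timeContraction_mem (n : ℕ) {q : ℝ × Space d}
    (hq : |q.1 - T / 2| * (1 - 1 / ((n : ℝ) + 2)) < T / 2) :
    timeContraction d T n q ∈ Ioo 0 T ×ˢ (univ : Set (Space d)) := by
  have h := one_div_nat_add_two_mem n
  have h1 : |(1 - 1 / ((n : ℝ) + 2)) * (q.1 - T / 2)| < T / 2 := by
    rwa [abs_mul, abs_of_pos (by linarith [h.2]), mul_comm]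
  rw [abs_lt] at h1
  refine ⟨⟨?_, ?_⟩, mem_univ _⟩ <;> simp only [timeContraction] <;> linarith [h1.1, h1.2]

lemma timeContraction_mem_of_mem_slab (hT : 0 < T) (n : ℕ) {q : ℝ × Space d}
    (hq : q ∈ slab d T) : timeContraction d T n q ∈ Ioo 0 T ×ˢ (univ : Set (Space d)) := by
  have h := one_div_nat_add_two_mem n
  have h1 : |q.1 - T / 2| ≤ T / 2 := abs_le.2 ⟨by linarith [hq.1.1], by linarith [hq.1.2]⟩
  refine timeContraction_mem n ?_
  nlinarith [abs_nonneg (q.1 - T / 2), h.1, h.2]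

lemma hasFDerivAt_timeContraction (n : ℕ) (q : ℝ × Space d) :
    HasFDerivAt (timeContraction d T n)
      (((1 - 1 / ((n : ℝ) + 2)) • ContinuousLinearMap.fst ℝ ℝ (Space d)).prod
        (ContinuousLinearMap.snd ℝ ℝ (Space d))) q :=
  ((((hasFDerivAt_fst (𝕜 := ℝ)).sub_const _).const_mul _).const_add _).prodMk hasFDerivAt_snd

/-- Contraction in time: a function that is `C¹` only up to the boundary of the slab is
approximated by its compositions with time contractions, which extend to `C¹` functions on the
whole space after multiplication with a cutoff in time. -/
lemma weakResidual_eq_zero_of_isCb1 (hT : 0 < T) (hA3 : MarginalA3 T p) (hu : VelocityL1 T p u)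
    (hs : s ∈ Icc 0 T)
    (h : ∀ ψ : ℝ × Space d → ℝ, ContDiff ℝ ∞ ψ → HasCompactSupport ψ → weakResidual T p u s ψ = 0)
    {φ : ℝ × Space d → ℝ} (hφ : IsCb1 T φ) : weakResidual T p u s φ = 0 := by
  obtain ⟨C, hC, hC₀, hC₁⟩ := hφ.exists_bound
  have hε := fun n : ℕ => one_div_nat_add_two_mem n
  -- The cutoff is one on `[0,T]`; its outer radius is below `(T/2) / (1 - 1/(n+2))`, because
  -- `(1 + x) (1 - x) < 1`, so the contraction maps its support into `(0,T)`.
  let θ : ℕ → ContDiffBump (T / 2) := fun n =>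
    ⟨T / 2, T / 2 * (1 + 1 / ((n : ℝ) + 2)), by positivity, by nlinarith [(hε n).1]⟩
  let φn : ℕ → ℝ × Space d → ℝ := fun n q => θ n q.1 * φ (timeContraction d T n q)
  have hin : ∀ n q, q ∈ Ioo 0 T ×ˢ (univ : Set (Space d)) →
      φn n =ᶠ[𝓝 q] φ ∘ timeContraction d T n := by
    intro n q hq
    filter_upwards [(isOpen_Ioo.prod isOpen_univ).mem_nhds hq] with q' hq'
    have h1 : θ n q'.1 = 1 := (θ n).one_of_mem_closedBall (by
      rw [Metric.mem_closedBall, Real.dist_eq]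
      change _ ≤ T / 2
      exact abs_le.2 ⟨by linarith [hq'.1.1], by linarith [hq'.1.2]⟩)
    simp only [φn, h1, one_mul, Function.comp_apply]
  have hval : ∀ n, ∀ q ∈ slab d T, φn n q = φ (timeContraction d T n q) := by
    intro n q hq
    have h1 : θ n q.1 = 1 := (θ n).one_of_mem_closedBall (by
      rw [Metric.mem_closedBall, Real.dist_eq]
      change _ ≤ T / 2
      exact abs_le.2 ⟨by linarith [hq.1.1], by linarith [hq.1.2]⟩)
    simp only [φn, h1, one_mul]
  have hsmooth : ∀ n, ContDiff ℝ 1 (φn n) := by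
    intro n
    rw [contDiff_iff_contDiffAt]
    intro q
    by_cases hq : |q.1 - T / 2| * (1 - 1 / ((n : ℝ) + 2)) < T / 2
    · have h1 := openSlab_mem_nhds (timeContraction_mem n hq)
      exact ((θ n).contDiff.comp contDiff_fst).contDiffAt.mul
        ((hφ.1.contDiffAt h1).comp q (contDiff_timeContraction n).contDiffAt)
    · have h1 : T / 2 * (1 + 1 / ((n : ℝ) + 2)) < |q.1 - T / 2| := by
        by_contra! hcon
        have h2 := mul_le_mul_of_nonneg_right hcon
          (by linarith [(hε n).2] : 0 ≤ 1 - 1 / ((n : ℝ) + 2))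
        nlinarith [mul_pos hT (mul_pos (hε n).1 (hε n).1)]
      have h2 : φn n =ᶠ[𝓝 q] fun _ => 0 := by
        have h3 : {q : ℝ × Space d | T / 2 * (1 + 1 / ((n : ℝ) + 2)) < |q.1 - T / 2|} ∈ 𝓝 q :=
          (isOpen_lt continuous_const (by fun_prop)).mem_nhds h1
        filter_upwards [h3] with q' hq'
        have h4 : θ n q'.1 = 0 := (θ n).zero_of_le_dist (by
          rw [Real.dist_eq]; exact le_of_lt hq')
        simp only [φn, h4, zero_mul]
      exact contDiffAt_const.congr_of_eventuallyEq h2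
  have hder : ∀ n, ∀ q ∈ Ioo 0 T ×ˢ (univ : Set (Space d)), fderiv ℝ (φn n) q
      = (fderiv ℝ φ (timeContraction d T n q)).comp
        (((1 - 1 / ((n : ℝ) + 2)) • ContinuousLinearMap.fst ℝ ℝ (Space d)).prod
          (ContinuousLinearMap.snd ℝ ℝ (Space d))) := by
    intro n q hq
    rw [(hin n q hq).fderiv_eq]
    have h1 := timeContraction_mem_of_mem_slab hT n (prod_mono_left Ioo_subset_Icc_self hq)
    exact ((hφ.differentiableAt h1).hasFDerivAt.comp q (hasFDerivAt_timeContraction n q)).fderiv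
  have hnorm : ∀ n : ℕ, ‖((1 - 1 / ((n : ℝ) + 2)) • ContinuousLinearMap.fst ℝ ℝ (Space d)).prod
      (ContinuousLinearMap.snd ℝ ℝ (Space d))‖ ≤ 1 := by
    intro n
    refine ContinuousLinearMap.opNorm_le_bound _ zero_le_one fun v => ?_
    rw [one_mul]
    refine max_le ?_ (norm_snd_le v)
    have h1 := hε n
    refine le_trans ?_ (norm_fst_le v)
    change ‖(1 - 1 / ((n : ℝ) + 2)) * v.1‖ ≤ ‖v.1‖
    rw [norm_mul]
    refine mul_le_of_le_one_left (norm_nonneg _) ?_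
    rw [Real.norm_of_nonneg (by linarith [h1.2])]
    linarith [h1.1]
  have hbound₀ : ∀ n, ∀ q ∈ slab d T, |φn n q| ≤ C := fun n q hq => by
    rw [hval n q hq]
    exact hC₀ _ (prod_mono_left Ioo_subset_Icc_self (timeContraction_mem_of_mem_slab hT n hq))
  have hbound₁ : ∀ n, ∀ q ∈ Ioo 0 T ×ˢ (univ : Set (Space d)), ‖fderiv ℝ (φn n) q‖ ≤ C := by
    intro n q hq
    rw [hder n q hq]
    refine (ContinuousLinearMap.opNorm_comp_le _ _).trans ?_
    exact (mul_le_of_le_one_right (norm_nonneg _) (hnorm n)).trans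
      (hC₁ _ (timeContraction_mem_of_mem_slab hT n (prod_mono_left Ioo_subset_Icc_self hq)))
  have hlim : Tendsto (fun n => weakResidual T p u s (φn n)) atTop
      (𝓝 (weakResidual T p u s φ)) := by
    refine tendsto_weakResidual hA3 hu hs (fun n => (hsmooth n).continuous.continuousOn)
      hbound₀ hbound₁ (fun q hq => ?_) (fun q hq => ?_)
    · refine Tendsto.congr (fun n => (hval n q hq).symm) ?_
      refine ((hφ.1.continuousOn q hq).tendsto).comp (tendsto_nhdsWithin_iff.2
        ⟨tendsto_timeContraction q, Eventually.of_forall fun n => ?_⟩)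
      exact prod_mono_left Ioo_subset_Icc_self (timeContraction_mem_of_mem_slab hT n hq)
    · refine Tendsto.congr (fun n => (hder n q hq).symm) ?_
      have h1 : Tendsto (fun n => fderiv ℝ φ (timeContraction d T n q)) atTop
          (𝓝 (fderiv ℝ φ q)) :=
        ((hφ.1.contDiffAt (openSlab_mem_nhds hq)).continuousAt_fderiv one_ne_zero).tendsto.comp
          (tendsto_timeContraction q)
      have h2 : Tendsto (fun n : ℕ => ((1 - 1 / ((n : ℝ) + 2)) •
          ContinuousLinearMap.fst ℝ ℝ (Space d)).prod (ContinuousLinearMap.snd ℝ ℝ (Space d)))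
          atTop (𝓝 (ContinuousLinearMap.id ℝ (ℝ × Space d))) := by
        have h3 : Tendsto (fun n : ℕ => (1 : ℝ) / ((n : ℝ) + 2)) atTop (𝓝 0) :=
          tendsto_one_div_nat_add_two
        rw [tendsto_iff_norm_sub_tendsto_zero]
        refine squeeze_zero (fun n => norm_nonneg _) (fun n => ?_) h3
        refine ContinuousLinearMap.opNorm_le_bound _ (hε n).1.le fun v => ?_
        have h4 : (((1 - 1 / ((n : ℝ) + 2)) • ContinuousLinearMap.fst ℝ ℝ (Space d)).prod
            (ContinuousLinearMap.snd ℝ ℝ (Space d)) - ContinuousLinearMap.id ℝ (ℝ × Space d)) v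
            = (-(1 / ((n : ℝ) + 2)) * v.1, 0) := by
          ext1
          · change (1 - 1 / ((n : ℝ) + 2)) * v.1 - v.1 = _
            ring
          · change v.2 - v.2 = _
            exact sub_self _
        rw [h4, Prod.norm_mk, norm_zero, max_eq_left (norm_nonneg _), norm_mul, norm_neg,
          Real.norm_of_nonneg (hε n).1.le]
        exact mul_le_mul_of_nonneg_left (norm_fst_le v) (hε n).1.le
      have h3 := ((isBoundedBilinearMap_comp (𝕜 := ℝ) (E := ℝ × Space d) (F := ℝ × Space d)
        (G := ℝ)).continuous.tendsto (fderiv ℝ φ q, ContinuousLinearMap.id ℝ (ℝ × Space d))).comp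
        (h1.prodMk_nhds h2)
      rwa [ContinuousLinearMap.comp_id] at h3
  simp only [weakResidual_eq_zero_of_contDiff hA3 hu hs h (hsmooth _) (hbound₀ _) (hbound₁ _)]
    at hlim
  exact tendsto_nhds_unique hlim tendsto_const_nhds

end Approximation

/-! ### Admissibility -/

section Admissibility

variable {d : ℕ} {T : ℝ} {p : ℝ → Space d → ℝ} {u : ℝ → Space d → Space d}

lemma integral_mul_genA_eq (φ : ℝ × Space d → ℝ) (t : ℝ) :
    (∫ s in (0 : ℝ)..t, ∫ x, genA u φ s x * p s x)
      = ∫ s in (0 : ℝ)..t, ∫ x, p s x * genA u φ s x := by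
  simp only [mul_comm]

lemma continuityEquation_iff_weakResidual_eq_zero (hA3 : MarginalA3 T p) (hu : VelocityL1 T p u)
    {t : ℝ} (ht : t ∈ Icc 0 T) {φ : ℝ × Space d → ℝ} (hφ : IsCb1 T φ) :
    ((∫ x, φ (t, x) * p t x) - ∫ x, φ (0, x) * p 0 x
        = ∫ s in (0 : ℝ)..t, ∫ x, genA u φ s x * p s x) ↔ weakResidual T p u t φ = 0 := by
  have h : ∀ r, ∫ x, φ (r, x) * p r x = ∫ x, p r x * φ (r, x) := fun r => by simp only [mul_comm]
  rw [weakResidual_eq hA3 hu ht hφ, integral_mul_genA_eq, h, h]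
  constructor <;> intro h' <;> linarith

lemma isCb1_of_isTestFunction (hT : 0 < T) {φ : ℝ × Space d → ℝ} (hφ : IsTestFunction T φ) :
    IsCb1 T φ := by
  have h1 : ContDiff ℝ 1 φ := hφ.1.of_le (by exact_mod_cast le_top)
  obtain ⟨A, hA⟩ := hφ.2.1.exists_bound_of_continuous h1.continuous
  obtain ⟨B, hB⟩ := (hφ.2.1.fderiv ℝ).exists_bound_of_continuous
    (h1.continuous_fderiv one_ne_zero)
  exact isCb1_of_contDiff (C := max A B) hT h1 fun q _ =>
    ⟨(hA q).trans (le_max_left _ _), (hB q).trans (le_max_right _ _)⟩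

lemma isTestFunction_boundary {φ : ℝ × Space d → ℝ} (hφ : IsTestFunction T φ) {t : ℝ}
    (ht : t ∉ Ioo 0 T) (x : Space d) : φ (t, x) = 0 :=
  image_eq_zero_of_notMem_tsupport fun h => ht (hφ.2.2 h).1

/-- The continuity equation on `[0,T]` and the weak time derivative `g` of `p` give the weak
divergence of `p u`, namely `-g`. -/
lemma hasWeakDivL1_of_weakResidual_eq_zero (hT : 0 < T) (hA3 : MarginalA3 T p)
    (hu : VelocityL1 T p u) (h : ∀ φ, IsCb1 T φ → weakResidual T p u T φ = 0) :
    HasWeakDivL1 T p u := by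
  obtain ⟨g, hg, hgφ⟩ := hA3.weakDeriv
  refine ⟨-g, hg.neg, fun φ hφ => ?_⟩
  have hb := isCb1_of_isTestFunction hT hφ
  have hd : Differentiable ℝ φ := hφ.1.differentiable (by simp)
  have h1 := h φ hb
  have hz : ∀ t, t ∉ Ioo 0 T → ∫ x, φ (t, x) ∂marginalMeasure p t = 0 := fun t ht => by
    simp [isTestFunction_boundary hφ ht]
  rw [weakResidual, hz T (by simp), hz 0 (by simp), sub_zero, add_zero,
    integral_openFlowMeasure hA3 le_rfl] at h1
  -- The derivative in the direction `(1, 0)` is the part of `𝒜^u` with zero velocity.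
  have hu0 : VelocityL1 T p fun _ _ => 0 := integrable_zero _ _ _
  have i1 := (integrable_openFlowMeasure_iff hA3 le_rfl _).1
    (integrable_fderiv_apply hA3 hu le_rfl hb)
  have i0 := (integrable_openFlowMeasure_iff hA3 le_rfl _).1
    (integrable_fderiv_apply hA3 hu0 le_rfl hb)
  have e0 : ∀ q : ℝ × Space d, fderiv ℝ φ q (spaceTimeVelocity (fun _ _ => 0) q)
      = deriv (fun t => φ (t, q.2)) q.1 := fun q => by
    rw [← genA_eq_fderiv (hd q), genA, inner_zero_left, add_zero]
  have e1 : ∀ q : ℝ × Space d, p q.1 q.2 * ⟪u q.1 q.2, gradient (fun x => φ (q.1, x)) q.2⟫_ℝ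
      = p q.1 q.2 * fderiv ℝ φ q (spaceTimeVelocity u q)
        - p q.1 q.2 * fderiv ℝ φ q (spaceTimeVelocity (fun _ _ => 0) q) := fun q => by
    rw [e0, ← genA_eq_fderiv (hd q), genA]
    ring
  simp only [e1]
  rw [integral_sub i1 i0, h1]
  simp only [e0]
  rw [hgφ φ hφ]
  simp [integral_neg]

end Admissibility

theorem mainTheorem2 (d : ℕ) (T : ℝ) (hT : 0 < T)
    (K : SpaceTime d → ℝ) (hA1 : KernelA1 K) (hA2 : KernelA2 K)
    (𝓗 : Type*) [NormedAddCommGroup 𝓗] [InnerProductSpace ℝ 𝓗] [CompleteSpace 𝓗]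
    [RKHS ℝ 𝓗 (SpaceTime d) ℝ] (h𝓗 : IsRKHSOf K 𝓗)
    (p : ℝ → Space d → ℝ) (hA3 : MarginalA3 T p)
    (u : ℝ → Space d → Space d) (hu : VelocityL1 T p u) :
    ContDiff ℝ 1 K ∧
    (∀ ξ : SpaceTime d,
      IntegrableOn (fun q : ℝ × Space d => p q.1 q.2 * genA u (kernelSection K ξ) q.1 q.2)
        (slab d T)) ∧
    (∀ s ∈ Icc 0 T, ∃ h : 𝓗, (h : SpaceTime d → ℝ) = kernelResidual K p u s) ∧
    (IsAdmissible T p u ↔ ∀ s ∈ Icc 0 T, kernelResidual K p u s = 0) := by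
  have hsec := h𝓗.isCb1_kernelSection hA1 hA2 hT
  refine ⟨contDiff_kernel hA1 hA2, fun ξ => ?_,
    fun s hs => exists_coe_eq_kernelResidual h𝓗 hA1 hA2 hA3 hu hT hs, fun hadm s hs => ?_,
    fun h => ?_⟩
  · have h1 := (integrable_openFlowMeasure_iff hA3 le_rfl _).1
      ((integrable_fderiv_apply hA3 hu le_rfl (hsec ξ)).congr
        (ae_genA_eq_fderiv le_rfl (hsec ξ)).symm)
    exact h1.congr_set_ae openSlab_ae_eq_slab.symm
  · ext ξ
    rw [kernelResidual_eq_weakResidual h𝓗 hA1 hA2 hA3 hu hT hs]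
    exact (continuityEquation_iff_weakResidual_eq_zero hA3 hu hs (hsec ξ)).1
      (hadm.2.2 _ (hsec ξ) s hs)
  · have hz : ∀ s ∈ Icc 0 T, ∀ φ, IsCb1 T φ → weakResidual T p u s φ = 0 := fun s hs φ hφ =>
      weakResidual_eq_zero_of_isCb1 hT hA3 hu hs
        (fun ψ hψ hc => weakResidual_eq_zero_of_smooth hA1 hA2 hA3 hu hs (fun ξ => by
          rw [← kernelResidual_eq_weakResidual h𝓗 hA1 hA2 hA3 hu hT hs, h s hs]
          rfl) hψ hc) hφ
    exact ⟨hu, hasWeakDivL1_of_weakResidual_eq_zero hT hA3 hu (hz T ⟨hT.le, le_rfl⟩),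
      fun φ hφ t ht => (continuityEquation_iff_weakResidual_eq_zero hA3 hu ht hφ).2 (hz t ht φ hφ)⟩
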